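/- For $n\ge 0$ and $p\in[0,1]$ let $G(n,p)$ be the random graph on $n$ labelled vertices in which each of the $\binom n2$ possible edges is present independently with probability $p$, and let $q=1-p$. Let $\nu_n$ be the number of connected components of $G(n,p)$, let $p_n=\mathsf P\{\nu_n=1\}$ be the probability that $G(n,p)$ is connected, and let $pi_n$ be the probability that $G(n,p)$ has an isolated vertex (one symbol, not a product). (1) For all $n\ge 1$ and all $p\in[0,1)$, $$1-2nq^{n-1}\le p_n\le \frac1{nq^n},\qquad 1-\frac1{nq^n}\le pi_n\le nq^{n-1},\qquad nq^n\,p_n\le pi_{n+1},$$ where all quantities, including $pi_{n+1}$, are taken with the same edge probability $p$. (2) Let $p=p(n)\in[0,1]$ be a sequence of edge probabilities, $q=q(n)=1-p(n)$, and suppose that for some constant $C>0$ we have $nq^n\ge C$ for all sufficiently large $n$. Then there is a sequence $\varepsilon_n\to 0$ such that, with $X_n=\mathsf E(\nu_n-1)\,(1+\varepsilon_n)$, for all sufficiently large $n$ we have $X_n>0$ and $$1-2X_n\le p_n\le \frac1{X_n},\qquad 1-\frac1{X_n}\le pi_n\le X_n,\qquad X_n\,p_n\le pi_{n+1},$$ where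 all quantities with subscript $n$, and also $pi_{n+1}$, are taken with edge probability $p(n)$. If moreover $q^n\to 0$ as $n\to\infty$, then $\varepsilon_n$ can be chosen so that in addition $X_n=nq^n$ for all sufficiently large $n$; in particular $\mathsf E(\nu_n-1)\sim nq^n$ in that case. -/

import Mathlib

open MeasureTheory ProbabilityTheory Filter Topology unitInterval

namespace RandomGraph

/-- The probability that the binomial random graph on `n` labelled vertices is connected. -/
noncomputable def connProb (n : ℕ) (p : I) : ℝ :=
  (SimpleGraph.binomialRandom (Fin n) p).real {G | G.Connected}

/-- The probability that the binomial random graph on `n` labelled vertices has an isolated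
vertex. -/
noncomputable def isolProb (n : ℕ) (p : I) : ℝ :=
  (SimpleGraph.binomialRandom (Fin n) p).real {G | ∃ v, G.IsIsolated v}

/-- The number of connected components of a graph on `n` labelled vertices. -/
noncomputable def numComponents {n : ℕ} (G : SimpleGraph (Fin n)) : ℕ :=
  Nat.card G.ConnectedComponent

/-- The expectation of (number of connected components) `- 1` for the binomial random graph on `n`
labelled vertices. The subtraction is that of real numbers. -/
noncomputable def meanExcess (n : ℕ) (p : I) : ℝ :=
  ∫ G, ((numComponents G : ℝ) - 1) ∂(SimpleGraph.binomialRandom (Fin n) p)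

end RandomGraph

/-!
Write `q = 1 - p`, let `X` be the number of isolated vertices and `ν` the number of components.

The upper bounds for the connection probability and the lower bounds for the probability of an
isolated vertex come from a recursion in `n`. Deleting an isolated vertex from `G(n + 1, p)` leaves
an independent copy of `G(n, p)`, which gives
`(n + 1) q ^ n P(X = j in G(n, p)) ≤ (j + 1) P(X = j + 1 in G(n + 1, p))`
(`mul_real_card_isolatedVertices_le`). For `j = 0` the right side is at most the probability that
`G(n + 1, p)` has an isolated vertex, and a connected graph on at least two vertices has none.

The bound `1 - 2 n q ^ (n - 1)` is the union bound over the sets that no edge leaves; a disconnected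
graph has two proper ones, which saves a factor two (`two_mul_one_sub_connProb_le`). One may assume
`2 n q ^ (n - 1) ≤ 1`. The term for sets of size `k ≤ n / 2` is then at most `2 ^ (1 - k)` times
the term for `k = 1` as soon as `n ≥ 128`, and the finitely many smaller `n` are left to a computation
(`sum_choose_mul_pow_le`).

For the asymptotic statement `E(ν - 1)` is compared with `n q ^ n`. Unless all vertices are isolated,
`ν - 1 ≥ X` (`le_meanExcess`). In the other direction, all components but one have at most `n / 2`
vertices, so that `ν - 1` is at most `X` plus the number of components of sizes from `2` to `n / 2`
(`numComponents_le`). A component of size `k` has at least `k - 1` edges, and this alone bounds the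
expected number of such components by a geometric series whose ratio `smallRatio` tends to zero
with `q ^ n` (`meanSmallRichSets_le`, `smallRatio_pow_le`). Hence `E(ν - 1) ∼ n q ^ n` whenever
`q ^ n → 0` and `n q ^ n` is bounded below.

The choice `X n = n q ^ n` satisfies all the required inequalities: those that do not follow from
the first part are trivial for `n q ^ n ≥ 1`, and otherwise result from the third Bonferroni
inequality and the bound for small components (`eventually_le_mul_pow`). If `q ^ n` does not tend to
zero, this choice is made only for the `n` with `n q ^ (4 n) < 1`, along which `q ^ n` does tend to
zero. For the other `n`, two steps of the recursion show that the absence of isolated vertices has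
probability at most `1 / (2 n)`, and `X n = E(ν - 1)` will do (`meanExcess_inequalities`).
-/

namespace RandomGraph

open SimpleGraph Finset

/-! ### Probabilities of elementary events -/

instance discreteMeasurableSpace_simpleGraph {V : Type*} [Finite V] :
    DiscreteMeasurableSpace (SimpleGraph V) := by
  have : MeasurableSingletonClass (SimpleGraph V) := ⟨fun G => by
    have : ({G} : Set (SimpleGraph V)) = edgeSet ⁻¹' {G.edgeSet} := by
      ext H; simp
    rw [this]
    exact measurable_edgeSet (measurableSet_singleton _)⟩
  infer_instance

theorem one_sub_coe_nonneg (p : I) : 0 ≤ 1 - (p : ℝ) := sub_nonneg.2 p.2.2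

theorem one_sub_coe_le_one (p : I) : 1 - (p : ℝ) ≤ 1 := by linarith [p.2.1]

theorem one_sub_coe_pos {p : I} (hp : p < 1) : 0 < 1 - (p : ℝ) := by
  have : (p : ℝ) < 1 := hp
  linarith

/-- Independence of the edges: prescribing a set `A` of present and a disjoint set `B` of absent
edges. -/
theorem real_edges_present_absent {V : Type*} [Finite V] [DecidableEq V] (p : I)
    {A B : Finset (Sym2 V)} (hA : ∀ e ∈ A, ¬ e.IsDiag) (hB : ∀ e ∈ B, ¬ e.IsDiag)
    (hAB : Disjoint A B) :
    (binomialRandom V p).real {G | (∀ e ∈ A, e ∈ G.edgeSet) ∧ ∀ e ∈ B, e ∉ G.edgeSet} =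
      (p : ℝ) ^ #A * (1 - (p : ℝ)) ^ #B := by
  have key : binomialRandom V p {G | (∀ e ∈ A, e ∈ G.edgeSet) ∧ ∀ e ∈ B, e ∉ G.edgeSet} =
      toNNReal p ^ #A * toNNReal (σ p) ^ #B := by
    rw [binomialRandom_eq_map, Measure.map_apply measurable_fromEdgeSet (.of_discrete),
      setBernoulli_apply']
    have hset : (fun f : Sym2 V → Prop => {i | f i}) ⁻¹' (fromEdgeSet ⁻¹'
        {G : SimpleGraph V | (∀ e ∈ A, e ∈ G.edgeSet) ∧ ∀ e ∈ B, e ∉ G.edgeSet}) =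
        ((A ∪ B : Finset (Sym2 V)) : Set (Sym2 V)).pi
          (fun e => if e ∈ A then {True} else {False}) := by
      ext f
      simp only [Set.mem_preimage, Set.mem_ofPred_eq, edgeSet_fromEdgeSet, Set.mem_pi,
        Finset.mem_coe, Finset.mem_union]
      constructor
      · rintro ⟨h1, h2⟩ e he
        by_cases heA : e ∈ A
        · simpa [heA] using (h1 e heA).1
        · have heB := he.resolve_left heA
          have := h2 e heB
          have h3 := hB e heB
          simp only [heA, if_false, Set.mem_singleton_iff, eq_iff_iff, iff_false]
          intro hf
          exact this ⟨hf, h3⟩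
      · intro h
        refine ⟨fun e he => ⟨?_, hA e he⟩, fun e he hf => ?_⟩
        · simpa [he] using h e (Or.inl he)
        · have := h e (Or.inr he)
          have hn : e ∉ A := fun h' => Finset.disjoint_left.1 hAB h' he
          simp only [hn, if_false, Set.mem_singleton_iff, eq_iff_iff, iff_false] at this
          exact this hf.1
    rw [hset, Measure.infinitePi_pi _ (fun _ _ => .of_discrete), Finset.prod_union hAB]
    congr 1
    · rw [Finset.prod_congr rfl (g := fun _ => (toNNReal p : ENNReal))]
      · simp
      · intro e he
        simp [he, hA e he]
    · rw [Finset.prod_congr rfl (g := fun _ => (toNNReal (σ p) : ENNReal))]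
      · simp
      · intro e he
        have hn : e ∉ A := fun h' => Finset.disjoint_left.1 hAB h' he
        simp [hn, hB e he]
  rw [measureReal_def, key]
  simp

theorem real_singleton (n : ℕ) (p : I) (G : SimpleGraph (Fin n)) :
    (binomialRandom (Fin n) p).real {G} =
      (p : ℝ) ^ G.edgeSet.ncard * (1 - (p : ℝ)) ^ (n.choose 2 - G.edgeSet.ncard) := by
  rw [measureReal_def, binomialRandom_singleton]
  simp

/-- Deleting the vertex `v` from `G(n + 1, p)` leaves a copy of `G(n, p)` which is independent of
the event that `v` is isolated. -/
theorem real_isIsolated_and_comap_succAbove (n : ℕ) (p : I) (v : Fin (n + 1))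
    (Q : Set (SimpleGraph (Fin n))) :
    (binomialRandom (Fin (n + 1)) p).real {G | G.IsIsolated v ∧ G.comap v.succAbove ∈ Q} =
      (1 - (p : ℝ)) ^ n * (binomialRandom (Fin n) p).real Q := by
  classical
  have hinj : Function.Injective (fun H : SimpleGraph (Fin n) => H.map v.succAboveEmb) :=
    SimpleGraph.map_injective _
  have hset : {G : SimpleGraph (Fin (n + 1)) | G.IsIsolated v ∧ G.comap v.succAbove ∈ Q} =
      (((Set.toFinite Q).toFinset.image (fun H => H.map v.succAboveEmb) :
        Finset (SimpleGraph (Fin (n + 1)))) : Set (SimpleGraph (Fin (n + 1)))) := by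
    ext G
    simp only [Set.mem_ofPred_eq, Finset.coe_image, Set.Finite.coe_toFinset, Set.mem_image]
    constructor
    · rintro ⟨h1, h2⟩
      refine ⟨_, h2, ?_⟩
      ext a b
      constructor
      · rintro ⟨-, x, y, h, rfl, rfl⟩
        exact h
      · intro h
        have ha : a ≠ v := by
          rintro rfl; exact h1 b h
        have hb : b ≠ v := by
          rintro rfl; exact h1 a h.symm
        obtain ⟨x, rfl⟩ := Fin.exists_succAbove_eq ha
        obtain ⟨y, rfl⟩ := Fin.exists_succAbove_eq hb
        exact ⟨h.ne, x, y, h, rfl, rfl⟩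
    · rintro ⟨H, hH, rfl⟩
      refine ⟨?_, ?_⟩
      · intro w hw
        obtain ⟨-, x, y, -, h, -⟩ := hw
        exact Fin.succAbove_ne _ _ h
      · have : (H.map v.succAboveEmb).comap v.succAbove = H := SimpleGraph.comap_map_eq _ _
        rwa [this]
  rw [hset, ← sum_measureReal_singleton, Finset.sum_image (fun _ _ _ _ h => hinj h)]
  conv_rhs => rw [← Set.Finite.coe_toFinset (Set.toFinite Q), ← sum_measureReal_singleton]
  rw [Finset.mul_sum]
  refine Finset.sum_congr rfl fun H _ => ?_
  rw [real_singleton, real_singleton, SimpleGraph.edgeSet_map,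
    Set.ncard_image_of_injective _ (v.succAboveEmb.sym2Map.injective)]
  have hle : H.edgeSet.ncard ≤ n.choose 2 := by
    have h := Set.ncard_le_ncard (SimpleGraph.edgeSet_subset_compl_diagSet H) (Set.toFinite _)
    rw [← Nat.card_coe_set_eq (Sym2.diagSetᶜ), Nat.card_eq_fintype_card, Sym2.card_diagSet_compl,
      Fintype.card_fin] at h
    exact h
  have : (n + 1).choose 2 - H.edgeSet.ncard = n + (n.choose 2 - H.edgeSet.ncard) := by
    have : (n + 1).choose 2 = n + n.choose 2 := by
      rw [Nat.choose_succ_succ' n 1, Nat.choose_one_right]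
    omega
  rw [this, pow_add]
  ring

/-- The expected number of the events `A i`, `i ∈ s`, that occur. -/
theorem sum_real_eq_integral_card {Ω ι : Type*} [MeasurableSpace Ω] [DiscreteMeasurableSpace Ω]
    [Finite Ω] (μ : Measure Ω) [IsFiniteMeasure μ] (s : Finset ι) (A : ι → Set Ω)
    [∀ ω, DecidablePred fun i => ω ∈ A i] :
    ∑ i ∈ s, μ.real (A i) = ∫ ω, (#{i ∈ s | ω ∈ A i} : ℝ) ∂μ := by
  classical
  have h : ∀ ω, (#{i ∈ s | ω ∈ A i} : ℝ) = ∑ i ∈ s, (A i).indicator (1 : Ω → ℝ) ω := by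
    intro ω
    simp [Set.indicator_apply]
  simp_rw [h]
  rw [integral_finsetSum _ (fun _ _ => .of_finite)]
  refine Finset.sum_congr rfl fun i _ => ?_
  rw [integral_indicator_one .of_discrete]

/-- The edges of the complete graph that join `S` to its complement. -/
def cutEdges {V : Type*} [Fintype V] [DecidableEq V] (S : Finset V) : Finset (Sym2 V) :=
  (S ×ˢ Sᶜ).image fun x => s(x.1, x.2)

theorem card_cutEdges {V : Type*} [Fintype V] [DecidableEq V] (S : Finset V) :
    #(cutEdges S) = #S * (Fintype.card V - #S) := by
  rw [cutEdges, Finset.card_image_of_injOn, Finset.card_product, Finset.card_compl]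
  rintro ⟨a, b⟩ h1 ⟨c, d⟩ h2 h
  simp only [Finset.coe_product, Set.mem_prod, Finset.mem_coe, Finset.mem_compl] at h1 h2
  simp only [Sym2.eq, Sym2.rel_iff', Prod.mk.injEq, Prod.swap_prod_mk] at h
  rcases h with h | ⟨rfl, rfl⟩
  · simp [h]
  · exact absurd h1.1 h2.2

theorem not_isDiag_of_mem_cutEdges {V : Type*} [Fintype V] [DecidableEq V] {S : Finset V}
    {e : Sym2 V} (he : e ∈ cutEdges S) : ¬ e.IsDiag := by
  simp only [cutEdges, Finset.mem_image, Finset.mem_product, Finset.mem_compl, Prod.exists] at he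
  obtain ⟨a, b, ⟨h1, h2⟩, rfl⟩ := he
  rw [Sym2.mk_isDiag_iff]
  rintro rfl
  exact h2 h1

/-- A set of vertices is closed in `G` if no edge of `G` leaves it, that is, if it is a union of
connected components. -/
def IsClosedSet {V : Type*} (G : SimpleGraph V) (S : Finset V) : Prop :=
  ∀ a ∈ S, ∀ b ∉ S, ¬ G.Adj a b

theorem isClosedSet_iff {V : Type*} [Fintype V] [DecidableEq V] (G : SimpleGraph V)
    (S : Finset V) : IsClosedSet G S ↔ ∀ e ∈ cutEdges S, e ∉ G.edgeSet := by
  simp only [IsClosedSet, cutEdges, Finset.mem_image, Finset.mem_product, Finset.mem_compl,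
    Prod.exists]
  constructor
  · rintro h e ⟨a, b, ⟨ha, hb⟩, rfl⟩
    exact h a ha b hb
  · intro h a ha b hb hab
    exact h _ ⟨a, b, ⟨ha, hb⟩, rfl⟩ hab

theorem real_isClosedSet (n : ℕ) (p : I) (S : Finset (Fin n)) :
    (binomialRandom (Fin n) p).real {G | IsClosedSet G S} =
      (1 - (p : ℝ)) ^ (#S * (n - #S)) := by
  have h := real_edges_present_absent p (A := ∅) (B := cutEdges S) (by simp)
    (fun e he => not_isDiag_of_mem_cutEdges he) (by simp)
  simp only [Finset.notMem_empty, false_imp_iff, implies_true, true_and, Finset.card_empty,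
    pow_zero, one_mul, card_cutEdges, Fintype.card_fin] at h
  simp_rw [isClosedSet_iff]
  exact h

theorem real_forall_isIsolated (n : ℕ) (p : I) (S : Finset (Fin n)) :
    (binomialRandom (Fin n) p).real {G | ∀ v ∈ S, G.IsIsolated v} =
      (1 - (p : ℝ)) ^ (n.choose 2 - (n - #S).choose 2) := by
  set off : Finset (Fin n) → Finset (Sym2 (Fin n)) := fun T =>
    T.offDiag.image (Function.uncurry Sym2.mk) with hoff
  have hmem : ∀ T e, e ∈ off T ↔ ¬ e.IsDiag ∧ ∀ v ∈ e, v ∈ T := by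
    intro T e
    induction e with | _ a b =>
    simp only [hoff, Finset.mem_image, Finset.mem_offDiag, Prod.exists, Function.uncurry,
      Sym2.mk_isDiag_iff, Sym2.mem_iff, forall_eq_or_imp, forall_eq]
    constructor
    · rintro ⟨c, d, ⟨h1, h2, h3⟩, h⟩
      simp only [Sym2.eq, Sym2.rel_iff', Prod.mk.injEq, Prod.swap_prod_mk] at h
      rcases h with ⟨rfl, rfl⟩ | ⟨rfl, rfl⟩
      · exact ⟨h3, h1, h2⟩
      · exact ⟨fun h => h3 h.symm, h2, h1⟩
    · rintro ⟨h1, h2, h3⟩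
      exact ⟨a, b, ⟨h2, h3, h1⟩, rfl⟩
  have hsub : off Sᶜ ⊆ off univ := by
    intro e he
    rw [hmem] at he ⊢
    exact ⟨he.1, by simp⟩
  have h := real_edges_present_absent p (A := ∅) (B := off univ \ off Sᶜ) (by simp)
    (fun e he => ((hmem _ _).1 (Finset.mem_sdiff.1 he).1).1) (by simp)
  rw [Finset.card_sdiff_of_subset hsub] at h
  simp only [Finset.notMem_empty, false_imp_iff, implies_true, true_and, Finset.card_empty,
    pow_zero, one_mul] at h
  rw [hoff] at h
  simp only [Sym2.card_image_offDiag, Finset.card_compl, Finset.card_univ, Fintype.card_fin] at h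
  rw [← h]
  congr 1
  ext G
  simp only [Set.mem_ofPred_eq, Finset.mem_sdiff]
  constructor
  · rintro hS e ⟨-, h2⟩ he
    induction e with | _ a b =>
    apply h2
    change _ ∈ off _
    rw [hmem]
    simp only [Sym2.mk_isDiag_iff, Sym2.mem_iff, forall_eq_or_imp, forall_eq, Finset.mem_compl]
    have he' : G.Adj a b := he
    exact ⟨he'.ne, fun ha => hS a ha b he', fun hb => hS b hb a he'.symm⟩
  · intro h' v hv w hvw
    refine h' s(v, w) ⟨?_, ?_⟩ hvw
    · change _ ∈ off _
      rw [hmem]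
      simpa using hvw.ne
    · change _ ∉ off _
      rw [hmem]
      simp [hv]

/-! ### Isolated vertices -/

open scoped Classical in
/-- The set of isolated vertices of a graph. -/
noncomputable def isolatedVertices {V : Type*} [Fintype V] (G : SimpleGraph V) : Finset V :=
  {v | G.IsIsolated v}

theorem mem_isolatedVertices {V : Type*} [Fintype V] {G : SimpleGraph V} {v : V} :
    v ∈ isolatedVertices G ↔ G.IsIsolated v := by
  simp [isolatedVertices]

theorem isolatedVertices_of_isIsolated {n : ℕ} {G : SimpleGraph (Fin (n + 1))} {v : Fin (n + 1)}
    (hv : G.IsIsolated v) :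
    isolatedVertices G =
      insert v ((isolatedVertices (G.comap v.succAbove)).map v.succAboveEmb) := by
  ext w
  simp only [Finset.mem_insert, Finset.mem_map, mem_isolatedVertices, Fin.coe_succAboveEmb]
  constructor
  · intro hw
    by_cases h : w = v
    · exact Or.inl h
    · obtain ⟨x, rfl⟩ := Fin.exists_succAbove_eq h
      exact Or.inr ⟨x, fun y hy => hw _ hy, rfl⟩
  · rintro (rfl | ⟨x, hx, rfl⟩)
    · exact hv
    · intro w hw
      have h : w ≠ v := by
        rintro rfl; exact hv _ hw.symm
      obtain ⟨y, rfl⟩ := Fin.exists_succAbove_eq h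
      exact hx y hw

theorem card_isolatedVertices_of_isIsolated {n : ℕ} {G : SimpleGraph (Fin (n + 1))}
    {v : Fin (n + 1)} (hv : G.IsIsolated v) :
    #(isolatedVertices G) = #(isolatedVertices (G.comap v.succAbove)) + 1 := by
  rw [isolatedVertices_of_isIsolated hv, Finset.card_insert_of_notMem, Finset.card_map]
  simp only [Finset.mem_map, Fin.coe_succAboveEmb, not_exists, not_and]
  exact fun x _ h => Fin.succAbove_ne _ _ h

theorem isolProb_eq_one_sub (n : ℕ) (p : I) :
    isolProb n p = 1 - (binomialRandom (Fin n) p).real {G | #(isolatedVertices G) = 0} := by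
  rw [isolProb, ← probReal_compl_eq_one_sub .of_discrete]
  congr 1
  ext G
  simp [Finset.ext_iff, mem_isolatedVertices]

/-- Counting the graphs on `n + 1` vertices with `j + 1` isolated vertices by an isolated vertex
and the graph that remains after its deletion. -/
theorem mul_real_card_isolatedVertices_le (n j : ℕ) (p : I) :
    (n + 1) * (1 - (p : ℝ)) ^ n * (binomialRandom (Fin n) p).real {G | #(isolatedVertices G) = j} ≤
      (j + 1) * (binomialRandom (Fin (n + 1)) p).real {G | #(isolatedVertices G) = j + 1} := by
  classical
  set Q : Set (SimpleGraph (Fin n)) := {G | #(isolatedVertices G) = j}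
  have h := sum_real_eq_integral_card (binomialRandom (Fin (n + 1)) p) univ
    (fun v => {G | G.IsIsolated v ∧ G.comap v.succAbove ∈ Q})
  simp only [real_isIsolated_and_comap_succAbove, Finset.sum_const, Finset.card_univ,
    Fintype.card_fin, nsmul_eq_mul] at h
  push_cast at h
  rw [mul_assoc, h, ← integral_indicator_one .of_discrete, ← integral_const_mul]
  refine integral_mono .of_finite .of_finite fun G => ?_
  dsimp only
  by_cases hG : #(isolatedVertices G) = j + 1
  · have hle : #{v | G ∈ {G : SimpleGraph (Fin (n + 1)) | G.IsIsolated v ∧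
        G.comap v.succAbove ∈ Q}} ≤ j + 1 := by
      rw [← hG]
      refine Finset.card_le_card fun v hv => ?_
      simp only [Finset.mem_filter] at hv
      exact mem_isolatedVertices.2 hv.2.1
    rw [Set.indicator_of_mem (by exact hG)]
    simp only [Pi.one_apply, mul_one]
    exact_mod_cast hle
  · rw [Set.indicator_of_notMem (by exact hG), mul_zero]
    have : #{v | G ∈ {G : SimpleGraph (Fin (n + 1)) | G.IsIsolated v ∧
        G.comap v.succAbove ∈ Q}} = 0 := by
      rw [Finset.card_eq_zero, Finset.filter_eq_empty_iff]
      rintro v - ⟨h1, h2⟩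
      apply hG
      rw [card_isolatedVertices_of_isIsolated h1]
      have : #(isolatedVertices (G.comap v.succAbove)) = j := h2
      rw [this]
    rw [this]
    simp

theorem isolProb_le_one (n : ℕ) (p : I) : isolProb n p ≤ 1 := measureReal_le_one

theorem connProb_nonneg (n : ℕ) (p : I) : 0 ≤ connProb n p := measureReal_nonneg

theorem connProb_le_one (n : ℕ) (p : I) : connProb n p ≤ 1 := measureReal_le_one

theorem mul_one_sub_isolProb_le_isolProb (n : ℕ) (p : I) :
    (n + 1) * (1 - (p : ℝ)) ^ n * (1 - isolProb n p) ≤ isolProb (n + 1) p := by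
  have h := mul_real_card_isolatedVertices_le n 0 p
  rw [isolProb_eq_one_sub n, sub_sub_cancel]
  refine h.trans ?_
  rw [Nat.cast_zero, zero_add, one_mul, isolProb]
  refine measureReal_mono fun G hG => ?_
  have hG' : #(isolatedVertices G) = 1 := hG
  obtain ⟨v, hv⟩ := Finset.card_pos.1 (by rw [hG']; exact one_pos)
  exact ⟨v, mem_isolatedVertices.1 hv⟩

/-- Two steps of the recursion: the absence of isolated vertices in `G(n, p)` is compared with
the presence of exactly two of them in `G(n + 2, p)`. -/
theorem mul_one_sub_isolProb_le_two (n : ℕ) (p : I) :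
    (n + 2) * (n + 1) * (1 - (p : ℝ)) ^ (2 * n + 1) * (1 - isolProb n p) ≤ 2 := by
  have h0 := mul_real_card_isolatedVertices_le n 0 p
  have h1 := mul_real_card_isolatedVertices_le (n + 1) 1 p
  rw [isolProb_eq_one_sub n, sub_sub_cancel]
  have hle : (binomialRandom (Fin (n + 1 + 1)) p).real {G | #(isolatedVertices G) = 1 + 1} ≤ 1 :=
    measureReal_le_one
  have hq := one_sub_coe_nonneg p
  have h2 := mul_le_mul_of_nonneg_left h0
    (mul_nonneg (by positivity : (0 : ℝ) ≤ (n + 1 : ℕ) + 1) (pow_nonneg hq (n + 1)))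
  push_cast at h0 h1 h2
  calc _ = (n + 1 + 1) * (1 - (p : ℝ)) ^ (n + 1) * ((n + 1) * (1 - (p : ℝ)) ^ n *
        (binomialRandom (Fin n) p).real {G | #(isolatedVertices G) = 0}) := by
        rw [show 2 * n + 1 = (n + 1) + n by ring, pow_add]; ring
    _ ≤ _ := h2
    _ ≤ _ := by linarith

theorem connProb_le_one_sub_isolProb {n : ℕ} (hn : 2 ≤ n) (p : I) :
    connProb n p ≤ 1 - isolProb n p := by
  rw [isolProb_eq_one_sub n, sub_sub_cancel, connProb]
  refine measureReal_mono fun G hG => ?_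
  have : Nontrivial (Fin n) := Fin.nontrivial_iff_two_le.2 hn
  have hG' : G.Connected := hG
  simpa [Finset.ext_iff, mem_isolatedVertices] using
    fun v => hG'.preconnected.not_isIsolated v

theorem real_isIsolated (n : ℕ) (p : I) (v : Fin n) :
    (binomialRandom (Fin n) p).real {G | G.IsIsolated v} = (1 - (p : ℝ)) ^ (n - 1) := by
  have h := real_forall_isIsolated n p {v}
  obtain ⟨m, rfl⟩ : ∃ m, n = m + 1 := ⟨n - 1, by have := v.2; omega⟩
  simpa [Nat.choose_succ_succ' m 1] using h

theorem mul_connProb_le_isolProb (n : ℕ) (p : I) :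
    n * (1 - (p : ℝ)) ^ n * connProb n p ≤ isolProb (n + 1) p := by
  have hq := one_sub_coe_nonneg p
  rcases Nat.lt_or_ge n 2 with hn | hn
  · have h1 : (1 - (p : ℝ)) ^ n ≤ isolProb (n + 1) p := by
      rw [← Nat.add_sub_cancel (n := n) (m := 1), ← real_isIsolated (n + 1) p 0,
        Nat.add_sub_cancel]
      exact measureReal_mono fun G hG => ⟨0, hG⟩
    have h2 : (n : ℝ) ≤ 1 := by exact_mod_cast (by omega : n ≤ 1)
    refine le_trans ?_ h1
    calc (n : ℝ) * (1 - (p : ℝ)) ^ n * connProb n p ≤ 1 * (1 - (p : ℝ)) ^ n * 1 := by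
          have := connProb_nonneg n p
          have := connProb_le_one n p
          gcongr
      _ = _ := by ring
  · refine le_trans ?_ (mul_one_sub_isolProb_le_isolProb n p)
    have := connProb_le_one_sub_isolProb hn p
    have := connProb_nonneg n p
    gcongr
    linarith

theorem connProb_le {n : ℕ} (hn : 1 ≤ n) {p : I} (hp : p < 1) :
    connProb n p ≤ 1 / (n * (1 - (p : ℝ)) ^ n) := by
  have hq := one_sub_coe_pos hp
  have : (0 : ℝ) < n := by exact_mod_cast hn
  rw [le_div_iff₀ (by positivity), mul_comm]
  exact (mul_connProb_le_isolProb n p).trans (isolProb_le_one _ _)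

theorem one_sub_le_isolProb {n : ℕ} (hn : 1 ≤ n) {p : I} (hp : p < 1) :
    1 - 1 / (n * (1 - (p : ℝ)) ^ n) ≤ isolProb n p := by
  have hq := one_sub_coe_pos hp
  have h0 : (0 : ℝ) < n := by exact_mod_cast hn
  have h1 := (mul_one_sub_isolProb_le_isolProb n p).trans (isolProb_le_one _ _)
  have h2 : 1 - isolProb n p ≤ 1 / (n * (1 - (p : ℝ)) ^ n) := by
    rw [le_div_iff₀ (by positivity)]
    have := sub_nonneg.2 (isolProb_le_one n p)
    have := mul_nonneg (pow_nonneg hq.le n) this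
    nlinarith
  linarith

theorem isolProb_le (n : ℕ) (p : I) :
    isolProb n p ≤ n * (1 - (p : ℝ)) ^ (n - 1) := by
  have h : {G : SimpleGraph (Fin n) | ∃ v, G.IsIsolated v} =
      ⋃ v ∈ (univ : Finset (Fin n)), {G | G.IsIsolated v} := by
    ext G; simp
  rw [isolProb, h]
  refine (measureReal_biUnion_finset_le _ _).trans ?_
  simp [real_isIsolated]

theorem integral_choose_card_isolatedVertices (n j : ℕ) (p : I) :
    ∫ G, ((#(isolatedVertices G)).choose j : ℝ) ∂(binomialRandom (Fin n) p) =
      n.choose j * (1 - (p : ℝ)) ^ (n.choose 2 - (n - j).choose 2) := by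
  classical
  have h := sum_real_eq_integral_card (binomialRandom (Fin n) p) (powersetCard j (univ : Finset (Fin n)))
    (fun S => {G : SimpleGraph (Fin n) | ∀ v ∈ S, G.IsIsolated v})
  have h2 : ∀ G : SimpleGraph (Fin n), {S ∈ powersetCard j (univ : Finset (Fin n)) |
      G ∈ {G : SimpleGraph (Fin n) | ∀ v ∈ S, G.IsIsolated v}} =
      powersetCard j (isolatedVertices G) := by
    intro G
    ext S
    simp [Finset.mem_powersetCard, Finset.subset_iff, mem_isolatedVertices, and_comm]
  simp_rw [h2, Finset.card_powersetCard] at h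
  rw [← h, Finset.sum_congr rfl (g := fun _ => (1 - (p : ℝ)) ^ (n.choose 2 - (n - j).choose 2))]
  · simp
  · intro S hS
    rw [real_forall_isIsolated, (Finset.mem_powersetCard.1 hS).2]

theorem integral_card_isolatedVertices (n : ℕ) (p : I) :
    ∫ G, (#(isolatedVertices G) : ℝ) ∂(binomialRandom (Fin n) p) =
      n * (1 - (p : ℝ)) ^ (n - 1) := by
  have h := integral_choose_card_isolatedVertices n 1 p
  rcases n with _ | m
  · simpa using h
  · simpa [Nat.choose_succ_succ' m 1] using h

/-- The Bonferroni inequality of order three for the number of isolated vertices. -/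
theorem isolProb_le_bonferroni {n : ℕ} (hn : 3 ≤ n) (p : I) :
    isolProb n p ≤ n * (1 - (p : ℝ)) ^ (n - 1) - n.choose 2 * (1 - (p : ℝ)) ^ (2 * n - 3) +
      n.choose 3 * (1 - (p : ℝ)) ^ (3 * n - 6) := by
  have h2 := integral_choose_card_isolatedVertices n 2 p
  have h3 := integral_choose_card_isolatedVertices n 3 p
  obtain ⟨m, rfl⟩ : ∃ m, n = m + 3 := ⟨n - 3, by omega⟩
  have e1 : (m + 3).choose 2 = (m + 2) + (m + 1) + m + m.choose 2 := by
    simp only [Nat.choose_succ_succ' _ 1, Nat.choose_one_right, Nat.reduceAdd]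
    ring
  have e2 : (m + 1).choose 2 = m + m.choose 2 := by
    simp only [Nat.choose_succ_succ' _ 1, Nat.choose_one_right]
  rw [show m + 3 - 2 = m + 1 by omega, e2] at h2
  rw [show m + 3 - 3 = m by omega] at h3
  rw [show (m + 3).choose 2 - (m + m.choose 2) = 2 * (m + 3) - 3 by omega] at h2
  rw [show (m + 3).choose 2 - m.choose 2 = 3 * (m + 3) - 6 by omega] at h3
  rw [← h2, ← h3, ← integral_card_isolatedVertices, ← integral_sub .of_finite .of_finite,
    ← integral_add .of_finite .of_finite, isolProb, ← integral_indicator_one .of_discrete]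
  refine integral_mono .of_finite .of_finite fun G => ?_
  dsimp only
  by_cases hG : ∃ v, G.IsIsolated v
  · rw [Set.indicator_of_mem (by exact hG)]
    obtain ⟨v, hv⟩ := hG
    obtain ⟨x, hx⟩ : ∃ x, #(isolatedVertices G) = x + 1 :=
      ⟨#(isolatedVertices G) - 1, by
        have := Finset.card_pos.2 ⟨v, mem_isolatedVertices.2 hv⟩
        omega⟩
    rw [hx, Nat.choose_succ_succ' x 2, Nat.choose_succ_succ' x 1, Nat.choose_one_right]
    push_cast
    have : (0 : ℝ) ≤ x.choose 3 := Nat.cast_nonneg _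
    simp only [Pi.one_apply]
    linarith
  · have h0 : #(isolatedVertices G) = 0 := by
      simpa [Finset.ext_iff, mem_isolatedVertices] using hG
    rw [Set.indicator_of_notMem (by exact hG), h0]
    simp

/-! ### The union bound for disconnectedness -/

/-- A disconnected graph has at least two closed sets of vertices that are neither empty nor
everything: a component and its complement. -/
theorem two_mul_one_sub_connProb_le {n : ℕ} (hn : 1 ≤ n) (p : I) :
    2 * (1 - connProb n p) ≤
      ∑ k ∈ Ico 1 n, n.choose k * (1 - (p : ℝ)) ^ (k * (n - k)) := by
  classical
  have : Nonempty (Fin n) := ⟨⟨0, hn⟩⟩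
  set f : ℕ → ℝ := fun k => if k ∈ Ico 1 n then (1 - (p : ℝ)) ^ (k * (n - k)) else 0 with hf
  have hsum := Finset.sum_powerset_apply_card f (x := (univ : Finset (Fin n)))
  have hR : ∑ m ∈ range (#(univ : Finset (Fin n)) + 1), (#(univ : Finset (Fin n))).choose m • f m =
      ∑ k ∈ Ico 1 n, n.choose k * (1 - (p : ℝ)) ^ (k * (n - k)) := by
    rw [Finset.card_univ, Fintype.card_fin]
    have hA : ∑ k ∈ Ico 1 n, n.choose k * (1 - (p : ℝ)) ^ (k * (n - k)) =
        ∑ k ∈ Ico 1 n, n.choose k • f k :=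
      Finset.sum_congr rfl fun k hk => by simp only [hf, hk, if_true, nsmul_eq_mul]
    rw [hA]
    refine (Finset.sum_subset (fun k hk => ?_) fun k _ hk => ?_).symm
    · rw [Finset.mem_Ico] at hk
      rw [Finset.mem_range]
      omega
    · simp only [hf, hk, if_false, smul_zero]
  rw [← hR, ← hsum]
  have hcount := sum_real_eq_integral_card (binomialRandom (Fin n) p)
    ((univ : Finset (Fin n)).powerset.filter fun S => #S ∈ Ico 1 n)
    (fun S => {G | IsClosedSet G S})
  have hL : ∑ S ∈ (univ : Finset (Fin n)).powerset, f #S =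
      ∑ S ∈ (univ : Finset (Fin n)).powerset.filter (fun S => #S ∈ Ico 1 n),
        (binomialRandom (Fin n) p).real {G | IsClosedSet G S} := by
    rw [Finset.sum_filter]
    refine Finset.sum_congr rfl fun S _ => ?_
    rw [real_isClosedSet]
  rw [hL, hcount, connProb, ← probReal_compl_eq_one_sub .of_discrete,
    ← integral_indicator_one .of_discrete, ← integral_const_mul]
  refine integral_mono .of_finite .of_finite fun G => ?_
  dsimp only
  by_cases hG : G.Connected
  · rw [Set.indicator_of_notMem (by simpa using hG), mul_zero]
    positivity
  · rw [Set.indicator_of_mem (by simpa using hG)]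
    rw [SimpleGraph.connected_iff] at hG
    have hG' : ¬ G.Preconnected := fun h => hG ⟨h, this⟩
    simp only [SimpleGraph.Preconnected, not_forall] at hG'
    obtain ⟨u, v, huv⟩ := hG'
    set S : Finset (Fin n) := {w | G.Reachable u w} with hS
    have hu : u ∈ S := by simp [hS]
    have hv : v ∉ S := by simpa [hS] using huv
    have hSc : IsClosedSet G S := by
      intro a ha b hb hab
      simp only [hS, Finset.mem_filter, Finset.mem_univ, true_and] at ha hb
      exact hb (ha.trans hab.reachable)
    have hSc' : IsClosedSet G Sᶜ := by
      intro a ha b hb hab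
      simp only [Finset.mem_compl, not_not] at ha hb
      exact hSc b hb a ha hab.symm
    have hmem : ∀ T : Finset (Fin n), T.Nonempty → Tᶜ.Nonempty → #T ∈ Ico 1 n := by
      intro T h1 h2
      have := Finset.card_pos.2 h1
      have := Finset.card_pos.2 h2
      rw [Finset.card_compl, Fintype.card_fin] at this
      simp only [Finset.mem_Ico]
      omega
    have hne : S ≠ Sᶜ := fun h => (Finset.mem_compl.1 (h ▸ hu)) hu
    have hsub : ({S, Sᶜ} : Finset (Finset (Fin n))) ⊆ ({i ∈ (univ : Finset (Fin n)).powerset.filter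
        (fun S => #S ∈ Ico 1 n) | G ∈ {G | IsClosedSet G i}}) := by
      intro T hT
      simp only [Finset.mem_insert, Finset.mem_singleton] at hT
      have hv' : v ∈ Sᶜ := Finset.mem_compl.2 hv
      rcases hT with rfl | rfl
      · simp only [Finset.mem_filter, Finset.powerset_univ, Finset.mem_univ, true_and]
        exact ⟨hmem _ ⟨u, hu⟩ ⟨v, hv'⟩, hSc⟩
      · simp only [Finset.mem_filter, Finset.powerset_univ, Finset.mem_univ, true_and]
        exact ⟨hmem _ ⟨v, hv'⟩ ⟨u, by simpa using hu⟩, hSc'⟩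
    have h2 := Finset.card_le_card hsub
    rw [Finset.card_pair hne] at h2
    simp only [Pi.one_apply, mul_one]
    exact_mod_cast h2

/-! ### Estimating the union bound -/

theorem one_add_div_four_pow_le_factorial (k : ℕ) :
    (1 + (k : ℝ) / 4) ^ (k - 1) ≤ k.factorial := by
  rcases Nat.lt_or_ge k 8 with hk | hk
  · interval_cases k <;> norm_num [Nat.factorial]
  · induction k, hk using Nat.le_induction with
    | base => norm_num [Nat.factorial]
    | succ k hk ih =>
      obtain ⟨j, rfl⟩ : ∃ j, k = j + 1 := ⟨k - 1, by omega⟩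
      simp only [Nat.add_sub_cancel] at ih ⊢
      have hj : (7 : ℝ) ≤ j := by exact_mod_cast (by omega : 7 ≤ j)
      have hexp : (1 + 1 / ((j : ℝ) + 5)) ^ j ≤ 2.7182818286 := by
        calc (1 + 1 / ((j : ℝ) + 5)) ^ j ≤ (Real.exp (1 / ((j : ℝ) + 5))) ^ j := by
              gcongr
              linarith [Real.add_one_le_exp (1 / ((j : ℝ) + 5))]
          _ = Real.exp (j * (1 / ((j : ℝ) + 5))) := by rw [Real.exp_nat_mul]
          _ ≤ Real.exp 1 := by
              rw [Real.exp_le_exp, mul_one_div, div_le_one (by positivity)]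
              linarith
          _ ≤ _ := Real.exp_one_lt_d9.le
      have hsplit : (1 + ((j + 1 + 1 : ℕ) : ℝ) / 4) =
          (1 + 1 / ((j : ℝ) + 5)) * (1 + ((j + 1 : ℕ) : ℝ) / 4) := by
        push_cast
        field_simp
        ring
      rw [Nat.factorial_succ, pow_succ, hsplit, mul_pow]
      push_cast at ih ⊢
      calc _ ≤ 2.7182818286 * ((j + 1).factorial : ℝ) *
            ((1 + 1 / ((j : ℝ) + 5)) * (1 + ((j : ℝ) + 1) / 4)) := by
            gcongr
        _ = (2.7182818286 * ((1 + 1 / ((j : ℝ) + 5)) * (1 + ((j : ℝ) + 1) / 4))) *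
              ((j + 1).factorial : ℝ) := by ring
        _ ≤ _ := by
            gcongr
            have : (1 + 1 / ((j : ℝ) + 5)) * (1 + ((j : ℝ) + 1) / 4) = (j + 6) / 4 := by
              field_simp
              ring
            rw [this]
            linarith

theorem two_mul_le_pow_nine_eighths {n : ℕ} (hn : 128 ≤ n) :
    (2 * n : ℝ) ≤ (9 / 8) ^ (n - 1) := by
  induction n, hn using Nat.le_induction with
  | base => norm_num
  | succ n hn ih =>
    obtain ⟨j, rfl⟩ : ∃ j, n = j + 1 := ⟨n - 1, by omega⟩
    simp only [Nat.add_sub_cancel] at ih ⊢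
    rw [pow_succ]
    have : (127 : ℝ) ≤ j := by exact_mod_cast (by omega : 127 ≤ j)
    push_cast at ih ⊢
    linarith

/-- If `w ^ (n - 1) = 2 n` then `w ^ k ≤ 1 + k / 4` for all `k ≤ n / 2`: since `w ^ n` is at most
`(1 + n / 8) ^ 2`, this follows from Bernoulli's inequality with exponent `n / (2 k)`. -/
theorem pow_le_one_add_div_four {n k : ℕ} (hn : 128 ≤ n) (hk : 1 ≤ k) (hkn : 2 * k ≤ n) {w : ℝ}
    (hw : 0 < w) (hwn : w ^ (n - 1) = 2 * n) : w ^ k ≤ 1 + k / 4 := by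
  have hn' : (128 : ℝ) ≤ n := by exact_mod_cast hn
  have hk' : (1 : ℝ) ≤ k := by exact_mod_cast hk
  have hkn' : 2 * (k : ℝ) ≤ n := by exact_mod_cast hkn
  have hw98 : w ≤ 9 / 8 := by
    have := two_mul_le_pow_nine_eighths hn
    rw [← hwn] at this
    exact le_of_pow_le_pow_left₀ (by omega) (by norm_num) this
  have hquad : 2 * (n : ℝ) * (9 / 8) ≤ (1 + n / 8 : ℝ) ^ 2 := by nlinarith only [hn']
  have hwn2 : w ^ n ≤ (1 + n / 8 : ℝ) ^ 2 := by
    refine le_trans ?_ hquad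
    obtain ⟨m, rfl⟩ : ∃ m, n = m + 1 := ⟨n - 1, by omega⟩
    simp only [Nat.add_sub_cancel] at hwn
    rw [pow_succ, hwn]
    gcongr
  have hbern : 1 + (n : ℝ) / 8 ≤ (1 + (k : ℝ) / 4) ^ ((n : ℝ) / (2 * k)) := by
    have := one_add_mul_self_le_rpow_one_add (s := (k : ℝ) / 4) (by linarith)
      (p := (n : ℝ) / (2 * k)) (by rw [le_div_iff₀ (by positivity)]; linarith)
    refine le_trans (le_of_eq ?_) this
    field_simp
    ring
  refine le_of_pow_le_pow_left₀ (n := n) (by omega) (by positivity) ?_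
  calc (w ^ k) ^ n = (w ^ n) ^ k := by rw [← pow_mul, ← pow_mul, mul_comm]
    _ ≤ ((1 + n / 8 : ℝ) ^ 2) ^ k := by gcongr
    _ = (1 + n / 8 : ℝ) ^ (2 * k) := by rw [← pow_mul]
    _ ≤ ((1 + (k : ℝ) / 4) ^ ((n : ℝ) / (2 * k))) ^ (2 * k) := by gcongr
    _ = (1 + (k : ℝ) / 4) ^ n := by
      rw [← Real.rpow_natCast _ (2 * k), ← Real.rpow_mul (by positivity), ← Real.rpow_natCast _ n]
      congr 1
      push_cast
      field_simp

/-- Up to the factor `n q ^ (n - 1)`, the left side is the term of the union bound for sets of size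
`k`. -/
theorem choose_mul_pow_le {n k : ℕ} (hn : 128 ≤ n) (hk : 1 ≤ k) (hkn : 2 * k ≤ n) {q : ℝ}
    (hq : 0 ≤ q) (hqn : 2 * n * q ^ (n - 1) ≤ 1) :
    n.choose k * q ^ ((k - 1) * (n - k - 1)) ≤ n * (1 / 2) ^ (k - 1) := by
  have hn0 : (0 : ℝ) < n := by exact_mod_cast (by omega : 0 < n)
  obtain ⟨w, hw, hwn⟩ : ∃ w : ℝ, 0 < w ∧ w ^ (n - 1) = 2 * n := by
    refine ⟨(2 * n : ℝ) ^ (((n - 1 : ℕ) : ℝ)⁻¹), by positivity, ?_⟩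
    exact Real.rpow_inv_natCast_pow (by positivity) (by omega)
  have hwk := pow_le_one_add_div_four hn hk hkn hw hwn
  have hqw : q * w ≤ 1 := by
    refine le_of_pow_le_pow_left₀ (n := n - 1) (by omega) zero_le_one ?_
    rw [mul_pow, hwn, one_pow]
    linarith
  have hb : n * q ^ (n - k - 1) ≤ (1 + (k : ℝ) / 4) / 2 := by
    have h1 : (q * w) ^ (n - k - 1) ≤ 1 := pow_le_one₀ (by positivity) hqw
    have h2 : w ^ (n - k - 1) * w ^ k = 2 * n := by
      rw [← pow_add, ← hwn]
      congr 1
      omega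
    rw [mul_pow] at h1
    have h3 : 2 * n * q ^ (n - k - 1) ≤ w ^ k := by
      calc 2 * n * q ^ (n - k - 1) = (q ^ (n - k - 1) * w ^ (n - k - 1)) * w ^ k := by
            rw [← h2]; ring
        _ ≤ 1 * w ^ k := by gcongr
        _ = w ^ k := one_mul _
    linarith
  have hfac : (0 : ℝ) < k.factorial := by exact_mod_cast k.factorial_pos
  calc (n.choose k : ℝ) * q ^ ((k - 1) * (n - k - 1))
      ≤ (n : ℝ) ^ k / k.factorial * q ^ ((k - 1) * (n - k - 1)) := by
        gcongr
        exact Nat.choose_le_pow_div k n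
    _ = n / k.factorial * (n * q ^ (n - k - 1)) ^ (k - 1) := by
        obtain ⟨j, rfl⟩ : ∃ j, k = j + 1 := ⟨k - 1, by omega⟩
        simp only [Nat.add_sub_cancel]
        rw [mul_pow, ← pow_mul, pow_succ, mul_comm j]
        ring
    _ ≤ n / k.factorial * ((1 + (k : ℝ) / 4) / 2) ^ (k - 1) := by gcongr
    _ = n * (1 / 2) ^ (k - 1) * ((1 + (k : ℝ) / 4) ^ (k - 1) / k.factorial) := by
        rw [div_pow, one_div_pow]; ring
    _ ≤ n * (1 / 2) ^ (k - 1) * 1 := by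
        gcongr
        rw [div_le_one hfac]
        exact one_add_div_four_pow_le_factorial k
    _ = _ := mul_one _

theorem sum_half_pow_le (s : Finset ℕ) (g : ℕ → ℕ) (hg : Set.InjOn g s)
    (hpos : ∀ k ∈ s, 1 ≤ g k) : ∑ k ∈ s, (1 / 2 : ℝ) ^ g k ≤ 1 := by
  rw [← Finset.sum_image (f := fun j => (1 / 2 : ℝ) ^ j) hg]
  have hsum : Summable fun j : ℕ => (1 / 2 : ℝ) ^ j := summable_geometric_two
  have h0 : (0 : ℕ) ∉ s.image g := by
    simp only [Finset.mem_image, not_exists, not_and]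
    intro k hk h
    have := hpos k hk
    omega
  have h := hsum.sum_le_tsum (insert 0 (s.image g)) (fun _ _ => by positivity)
  rw [tsum_geometric_two, Finset.sum_insert h0] at h
  norm_num at h ⊢
  linarith

/-- A finite computation: for `n < 128` there is a rational upper bound `a / 200` of the
solution of `2 n q ^ (n - 1) = 1` for which the union bound is still good enough. -/
theorem exists_rational_union_bound : ∀ n < 128, 2 ≤ n → ∃ a ≤ 200,
    200 ^ (n - 1) ≤ 2 * n * a ^ (n - 1) ∧
    ∑ k ∈ Ico 2 (n - 1), n.choose k * (a ^ ((k - 1) * (n - k - 1)) *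
      200 ^ (n ^ 2 - (k - 1) * (n - k - 1))) ≤ 2 * n * 200 ^ (n ^ 2) := by
  decide +kernel

theorem sum_insert_le {ι : Type*} [DecidableEq ι] {f : ι → ℝ} {a : ι} {s : Finset ι}
    (ha : 0 ≤ f a) : ∑ x ∈ insert a s, f x ≤ f a + ∑ x ∈ s, f x := by
  by_cases h : a ∈ s
  · rw [Finset.insert_eq_of_mem h]
    linarith
  · rw [Finset.sum_insert h]

theorem sum_choose_mul_pow_le {n : ℕ} (hn : 2 ≤ n) {q : ℝ} (hq : 0 ≤ q)
    (hqn : 2 * n * q ^ (n - 1) ≤ 1) :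
    ∑ k ∈ Ico 2 (n - 1), n.choose k * q ^ ((k - 1) * (n - k - 1)) ≤ 2 * n := by
  rcases Nat.lt_or_ge n 128 with h128 | h128
  · obtain ⟨a, -, h1, h2⟩ := exists_rational_union_bound n h128 hn
    have hn0 : (0 : ℝ) < n := by exact_mod_cast (by omega : 0 < n)
    have hqa : q ≤ a / 200 := by
      refine le_of_pow_le_pow_left₀ (n := n - 1) (by omega) (by positivity) ?_
      have h1' : (200 : ℝ) ^ (n - 1) ≤ 2 * n * a ^ (n - 1) := by exact_mod_cast h1
      rw [div_pow, le_div_iff₀ (by positivity)]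
      have hqp := pow_nonneg hq (n - 1)
      calc q ^ (n - 1) * 200 ^ (n - 1) ≤ q ^ (n - 1) * (2 * n * a ^ (n - 1)) := by gcongr
        _ = (2 * n * q ^ (n - 1)) * a ^ (n - 1) := by ring
        _ ≤ 1 * a ^ (n - 1) := by gcongr
        _ = _ := one_mul _
    have h2' : (∑ k ∈ Ico 2 (n - 1), n.choose k * (a ^ ((k - 1) * (n - k - 1)) *
      200 ^ (n ^ 2 - (k - 1) * (n - k - 1))) : ℝ) ≤ 2 * n * 200 ^ (n ^ 2) := by exact_mod_cast h2
    have hP : (0 : ℝ) < 200 ^ (n ^ 2) := by positivity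
    refine le_of_mul_le_mul_right ?_ hP
    refine le_trans ?_ h2'
    rw [Finset.sum_mul]
    refine Finset.sum_le_sum fun k _ => ?_
    rw [mul_assoc]
    refine mul_le_mul_of_nonneg_left ?_ (Nat.cast_nonneg _)
    have hle : (k - 1) * (n - k - 1) ≤ n ^ 2 := by
      rw [pow_two]
      rcases Nat.lt_or_ge n k with h | h
      · rw [show n - k - 1 = 0 by omega]; simp
      · exact Nat.mul_le_mul (by omega) (by omega)
    calc q ^ ((k - 1) * (n - k - 1)) * (200 : ℝ) ^ (n ^ 2)
        ≤ ((a : ℝ) / 200) ^ ((k - 1) * (n - k - 1)) * (200 : ℝ) ^ (n ^ 2) := by gcongr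
      _ = _ := by
        rw [div_pow]
        rw [← Nat.add_sub_of_le hle, pow_add, Nat.add_sub_cancel_left]
        field_simp
  · have hterm : ∀ k ∈ Ico 2 (n - 1), (n.choose k * q ^ ((k - 1) * (n - k - 1)) : ℝ) ≤
        n * (1 / 2) ^ (k - 1) + n * (1 / 2) ^ (n - k - 1) := by
      intro k hk
      rw [Finset.mem_Ico] at hk
      rcases le_total (2 * k) n with h | h
      · have := choose_mul_pow_le h128 (by omega) h hq hqn
        have : (0 : ℝ) ≤ n * (1 / 2) ^ (n - k - 1) := by positivity
        linarith
      · have := choose_mul_pow_le h128 (k := n - k) (by omega) (by omega) hq hqn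
        rw [Nat.choose_symm (by omega), show n - (n - k) - 1 = k - 1 by omega, mul_comm (n - k - 1)]
          at this
        have : (0 : ℝ) ≤ n * (1 / 2) ^ (k - 1) := by positivity
        linarith
    refine (Finset.sum_le_sum hterm).trans ?_
    rw [Finset.sum_add_distrib, ← Finset.mul_sum, ← Finset.mul_sum]
    have h1 := sum_half_pow_le (Ico 2 (n - 1)) (fun k => k - 1)
      (by
        intro a ha b hb h
        simp only [Finset.coe_Ico, Set.mem_Ico] at ha hb h
        omega)
      (by
        intro k hk
        rw [Finset.mem_Ico] at hk
        omega)
    have h2 := sum_half_pow_le (Ico 2 (n - 1)) (fun k => n - k - 1)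
      (by
        intro a ha b hb h
        simp only [Finset.coe_Ico, Set.mem_Ico] at ha hb h
        omega)
      (by
        intro k hk
        rw [Finset.mem_Ico] at hk
        omega)
    have hn0 : (0 : ℝ) ≤ n := Nat.cast_nonneg n
    have := mul_le_mul_of_nonneg_left h1 hn0
    have := mul_le_mul_of_nonneg_left h2 hn0
    linarith

theorem one_sub_le_connProb {n : ℕ} (hn : 1 ≤ n) (p : I) :
    1 - 2 * n * (1 - (p : ℝ)) ^ (n - 1) ≤ connProb n p := by
  have hq := one_sub_coe_nonneg p
  set q := 1 - (p : ℝ)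
  have hc := connProb_nonneg n p
  rcases le_or_gt 1 (2 * n * q ^ (n - 1)) with h | h
  · linarith
  have hn2 : 2 ≤ n := by
    by_contra h'
    obtain rfl : n = 1 := by omega
    norm_num at h
  have h1 := two_mul_one_sub_connProb_le hn p
  have hsub : Ico 1 n ⊆ insert 1 (insert (n - 1) (Ico 2 (n - 1))) := by
    intro k hk
    simp only [Finset.mem_insert, Finset.mem_Ico] at hk ⊢
    omega
  have hnn : ∀ k, 0 ≤ (n.choose k : ℝ) * q ^ (k * (n - k)) := fun k => by positivity
  have h2 := Finset.sum_le_sum_of_subset_of_nonneg hsub (f := fun k =>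
    (n.choose k : ℝ) * q ^ (k * (n - k))) (fun k _ _ => hnn k)
  have h3 : ∑ k ∈ insert 1 (insert (n - 1) (Ico 2 (n - 1))), (n.choose k : ℝ) * q ^ (k * (n - k)) ≤
      n * q ^ (n - 1) + (n * q ^ (n - 1) +
        ∑ k ∈ Ico 2 (n - 1), (n.choose k : ℝ) * q ^ (k * (n - k))) := by
    refine (sum_insert_le (f := fun k => (n.choose k : ℝ) * q ^ (k * (n - k))) (hnn 1)).trans ?_
    refine add_le_add (by simp) ?_
    refine (sum_insert_le (f := fun k => (n.choose k : ℝ) * q ^ (k * (n - k))) (hnn _)).trans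
      (add_le_add (le_of_eq ?_) le_rfl)
    rw [Nat.choose_symm (by omega : 1 ≤ n), show n - (n - 1) = 1 by omega]
    simp
  have h4 : ∑ k ∈ Ico 2 (n - 1), (n.choose k : ℝ) * q ^ (k * (n - k)) =
      q ^ (n - 1) * ∑ k ∈ Ico 2 (n - 1), n.choose k * q ^ ((k - 1) * (n - k - 1)) := by
    rw [Finset.mul_sum]
    refine Finset.sum_congr rfl fun k hk => ?_
    rw [Finset.mem_Ico] at hk
    have : k * (n - k) = (n - 1) + (k - 1) * (n - k - 1) := by
      obtain ⟨a, rfl⟩ : ∃ a, k = a + 1 := ⟨k - 1, by omega⟩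
      obtain ⟨b, rfl⟩ : ∃ b, n = a + 1 + (b + 1) := ⟨n - (a + 1) - 1, by omega⟩
      rw [show a + 1 + (b + 1) - (a + 1) = b + 1 by omega, Nat.add_sub_cancel, Nat.add_sub_cancel,
        show a + 1 + (b + 1) - 1 = a + b + 1 by omega]
      ring
    rw [this, pow_add]
    ring
  have h5 := mul_le_mul_of_nonneg_left (sum_choose_mul_pow_le hn2 hq h.le) (pow_nonneg hq (n - 1))
  rw [h4] at h3
  linarith

/-! ### Small components with more than one vertex -/

/-- The edges of the complete graph on the set `S`. -/
def edgesWithin {V : Type*} [DecidableEq V] (S : Finset V) : Finset (Sym2 V) :=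
  S.offDiag.image (Function.uncurry Sym2.mk)

theorem mem_edgesWithin {V : Type*} [DecidableEq V] {S : Finset V} {a b : V} :
    s(a, b) ∈ edgesWithin S ↔ a ∈ S ∧ b ∈ S ∧ a ≠ b := by
  simp only [edgesWithin, Finset.mem_image, Finset.mem_offDiag, Prod.exists, Function.uncurry]
  constructor
  · rintro ⟨c, d, ⟨h1, h2, h3⟩, h⟩
    simp only [Sym2.eq, Sym2.rel_iff', Prod.mk.injEq, Prod.swap_prod_mk] at h
    rcases h with ⟨rfl, rfl⟩ | ⟨rfl, rfl⟩
    · exact ⟨h1, h2, h3⟩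
    · exact ⟨h2, h1, h3.symm⟩
  · rintro ⟨h1, h2, h3⟩
    exact ⟨a, b, ⟨h1, h2, h3⟩, rfl⟩

/-- `S` is closed in `G` and spans at least `#S - 1` edges. Every connected component has this
property, and its probability is easy to bound; connectedness of the graph spanned by `S` enters
only through this number of edges. -/
def IsRichClosedSet {V : Type*} [DecidableEq V] (G : SimpleGraph V) (S : Finset V) : Prop :=
  IsClosedSet G S ∧ ∃ A ∈ powersetCard (#S - 1) (edgesWithin S), ∀ e ∈ A, e ∈ G.edgeSet

open scoped Classical in
/-- The sets `S` with `2 ≤ #S ≤ n / 2` that are closed and span at least `#S - 1` edges. -/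
noncomputable def smallRichSets {n : ℕ} (G : SimpleGraph (Fin n)) : Finset (Finset (Fin n)) :=
  {S | (2 ≤ #S ∧ 2 * #S ≤ n) ∧ IsRichClosedSet G S}

theorem real_isRichClosedSet_le (n : ℕ) (p : I) (S : Finset (Fin n)) :
    (binomialRandom (Fin n) p).real {G | IsRichClosedSet G S} ≤
      ((#S).choose 2).choose (#S - 1) * ((p : ℝ) ^ (#S - 1) * (1 - (p : ℝ)) ^ (#S * (n - #S))) := by
  have hset : {G : SimpleGraph (Fin n) | IsRichClosedSet G S} =
      ⋃ A ∈ powersetCard (#S - 1) (edgesWithin S),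
        {G | (∀ e ∈ A, e ∈ G.edgeSet) ∧ ∀ e ∈ cutEdges S, e ∉ G.edgeSet} := by
    ext G
    simp only [Set.mem_ofPred_eq, IsRichClosedSet, isClosedSet_iff, Set.mem_iUnion, exists_prop]
    constructor
    · rintro ⟨h1, A, hA, h2⟩
      exact ⟨A, hA, h2, h1⟩
    · rintro ⟨A, hA, h2, h1⟩
      exact ⟨h1, A, hA, h2⟩
  rw [hset]
  refine (measureReal_biUnion_finset_le _ _).trans (le_of_eq ?_)
  rw [Finset.sum_congr rfl
    (g := fun _ => (p : ℝ) ^ (#S - 1) * (1 - (p : ℝ)) ^ (#S * (n - #S)))]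
  · rw [Finset.sum_const, Finset.card_powersetCard, edgesWithin, Sym2.card_image_offDiag,
      nsmul_eq_mul]
  · intro A hA
    rw [Finset.mem_powersetCard] at hA
    have hdiag : ∀ e ∈ edgesWithin S, ¬ e.IsDiag := by
      intro e he
      induction e with | _ a b =>
      rw [mem_edgesWithin] at he
      simpa using he.2.2
    have hdisj : Disjoint A (cutEdges S) := by
      rw [Finset.disjoint_left]
      intro e he hc
      have he' := hA.1 he
      simp only [cutEdges, Finset.mem_image, Finset.mem_product, Finset.mem_compl,
        Prod.exists] at hc
      obtain ⟨a, b, ⟨h1, h2⟩, rfl⟩ := hc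
      exact h2 (mem_edgesWithin.1 he').2.1
    rw [real_edges_present_absent p (fun e he => hdiag e (hA.1 he))
      (fun e he => not_isDiag_of_mem_cutEdges he) hdisj, hA.2, card_cutEdges, Fintype.card_fin]

open scoped Classical in
theorem isRichClosedSet_supp {n : ℕ} {G : SimpleGraph (Fin n)} (c : G.ConnectedComponent) :
    IsRichClosedSet G c.supp.toFinset := by
  refine ⟨?_, ?_⟩
  · intro a ha b hb hab
    rw [Set.mem_toFinset] at ha hb
    exact hb ((c.mem_supp_congr_adj hab).1 ha)
  · set E : Finset (Sym2 (Fin n)) := {e ∈ edgesWithin c.supp.toFinset | e ∈ G.edgeSet} with hE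
    have hcard := c.connected_toSimpleGraph.card_vert_le_card_edgeSet_add_one
    have h1 : Nat.card c = #c.supp.toFinset := by
      rw [Set.toFinset_card, ← Nat.card_eq_fintype_card]
      rfl
    have h2 : Nat.card c.toSimpleGraph.edgeSet ≤ #E := by
      rw [Nat.card_coe_set_eq, ← Set.ncard_image_of_injective (f := Sym2.map Subtype.val) _
        (Sym2.map.injective Subtype.val_injective), ← Set.ncard_coe_finset]
      refine Set.ncard_le_ncard ?_ (Set.toFinite _)
      rintro _ ⟨e, he, rfl⟩
      induction e with | _ a b =>
      have hab : G.Adj a b := he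
      rw [Sym2.map_mk]
      simp only [hE, Finset.coe_filter, Set.mem_ofPred_eq, mem_edgesWithin, Set.mem_toFinset]
      exact ⟨⟨a.2, b.2, hab.ne⟩, hab⟩
    obtain ⟨A, hA, hA2⟩ := Finset.exists_subset_card_eq (s := E)
      (n := #c.supp.toFinset - 1) (by omega)
    refine ⟨A, Finset.mem_powersetCard.2 ⟨hA.trans (Finset.filter_subset _ _), hA2⟩, ?_⟩
    intro e he
    exact (Finset.mem_filter.1 (hA he)).2

/-- All components but at most one have at most `n / 2` vertices, and those are isolated vertices
or have at least two vertices. -/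
theorem numComponents_le {n : ℕ} (G : SimpleGraph (Fin n)) :
    numComponents G ≤ 1 + #(isolatedVertices G) + #(smallRichSets G) := by
  classical
  rw [numComponents, Nat.card_eq_fintype_card, ← Finset.card_univ]
  set size : G.ConnectedComponent → ℕ := fun c => #c.supp.toFinset with hsize
  have hpos : ∀ c, 1 ≤ size c := by
    intro c
    obtain ⟨v, hv⟩ := c.nonempty_supp
    exact Finset.card_pos.2 ⟨v, Set.mem_toFinset.2 hv⟩
  set B : Finset G.ConnectedComponent := {c | n < 2 * size c} with hB
  set J : Finset G.ConnectedComponent := {c | size c = 1} with hJ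
  set M : Finset G.ConnectedComponent := {c | 2 ≤ size c ∧ 2 * size c ≤ n} with hM
  have hcover : (univ : Finset G.ConnectedComponent) ⊆ B ∪ J ∪ M := by
    intro c _
    have := hpos c
    simp only [hB, hJ, hM, Finset.mem_union, Finset.mem_filter, Finset.mem_univ, true_and]
    omega
  have hBcard : #B ≤ 1 := by
    rw [Finset.card_le_one]
    intro c hc d hd
    by_contra hcd
    have hdis : Disjoint c.supp.toFinset d.supp.toFinset := by
      rw [Set.disjoint_toFinset]
      exact pairwise_disjoint_supp_connectedComponent G hcd
    have h1 := Finset.card_union_of_disjoint hdis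
    have h2 := Finset.card_le_univ (c.supp.toFinset ∪ d.supp.toFinset)
    rw [Fintype.card_fin] at h2
    simp only [hB, hsize, Finset.mem_filter, Finset.mem_univ, true_and] at hc hd
    omega
  have hJcard : #J ≤ #(isolatedVertices G) := by
    refine le_trans (Finset.card_le_card (t := (isolatedVertices G).image G.connectedComponentMk)
      ?_) Finset.card_image_le
    intro c hc
    simp only [hJ, hsize, Finset.mem_filter, Finset.mem_univ, true_and] at hc
    obtain ⟨v, hv⟩ := Finset.card_eq_one.1 hc
    have hmem : ∀ w, w ∈ c.supp ↔ w = v := by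
      intro w
      rw [← Set.mem_toFinset, hv, Finset.mem_singleton]
    have hvc : v ∈ c.supp := (hmem v).2 rfl
    refine Finset.mem_image.2 ⟨v, mem_isolatedVertices.2 fun w hw => ?_, hvc⟩
    exact hw.ne ((hmem w).1 ((c.mem_supp_congr_adj hw).1 hvc)).symm
  have hMcard : #M ≤ #(smallRichSets G) := by
    refine Finset.card_le_card_of_injOn (fun c => c.supp.toFinset) ?_ ?_
    · intro c hc
      simp only [hM, hsize, Finset.coe_filter, Finset.mem_univ, true_and, Set.mem_ofPred_eq] at hc
      simp only [smallRichSets, Finset.coe_filter, Finset.mem_univ, true_and, Set.mem_ofPred_eq]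
      exact ⟨hc, isRichClosedSet_supp c⟩
    · intro c _ d _ h
      exact ConnectedComponent.supp_injective (Set.toFinset_inj.1 h)
  have h1 := Finset.card_le_card hcover
  have h2 := Finset.card_union_le (B ∪ J) M
  have h3 := Finset.card_union_le B J
  omega

theorem card_isolatedVertices_le_numComponents {n : ℕ} (G : SimpleGraph (Fin n)) :
    #(isolatedVertices G) ≤ numComponents G ∧
      (#(isolatedVertices G) ≠ n → #(isolatedVertices G) < numComponents G) := by
  classical
  have hinj : ∀ v w, G.IsIsolated v → G.connectedComponentMk v = G.connectedComponentMk w →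
      v = w := by
    intro v w hv h
    by_contra hne
    obtain ⟨P⟩ := ConnectedComponent.exact h
    cases P with
    | nil => exact hne rfl
    | cons hadj _ => exact hv _ hadj
  have hcard : #((isolatedVertices G).image G.connectedComponentMk) = #(isolatedVertices G) :=
    Finset.card_image_of_injOn fun v hv w _ h => hinj v w (mem_isolatedVertices.1 hv) h
  rw [numComponents, Nat.card_eq_fintype_card, ← Finset.card_univ, ← hcard]
  refine ⟨Finset.card_le_card (Finset.subset_univ _), fun h => Finset.card_lt_card ?_⟩
  rw [hcard] at h
  have hne : isolatedVertices G ≠ univ := by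
    intro h'
    rw [h', Finset.card_univ, Fintype.card_fin] at h
    exact h rfl
  obtain ⟨v, -, hv⟩ := Finset.exists_of_ssubset ((Finset.ssubset_univ_iff).2 hne)
  rw [Finset.ssubset_univ_iff]
  intro hall
  have : G.connectedComponentMk v ∈ (isolatedVertices G).image G.connectedComponentMk := by
    rw [hall]; exact Finset.mem_univ _
  obtain ⟨w, hw, hwv⟩ := Finset.mem_image.1 this
  exact hv (hinj w v (mem_isolatedVertices.1 hw) hwv ▸ hw)

/-- Unless every vertex is isolated, the isolated vertices are not the only components. -/
theorem le_meanExcess {n : ℕ} (hn : 3 ≤ n) (p : I) :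
    (n - 1) * (1 - (p : ℝ)) ^ n ≤ meanExcess n p := by
  have hq0 := one_sub_coe_nonneg p
  have hq1 := one_sub_coe_le_one p
  have hall : (binomialRandom (Fin n) p).real {G | #(isolatedVertices G) = n} =
      (1 - (p : ℝ)) ^ (n.choose 2) := by
    have h := real_forall_isIsolated n p univ
    simp only [Finset.card_univ, Fintype.card_fin, Nat.sub_self, Nat.choose_zero_succ,
      Nat.sub_zero] at h
    rw [← h]
    congr 1
    ext G
    simp only [Set.mem_ofPred_eq, Finset.mem_univ, true_imp_iff]
    constructor
    · intro hG v
      rw [← mem_isolatedVertices, (Finset.card_eq_iff_eq_univ (isolatedVertices G)).1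
        (by rw [hG, Fintype.card_fin])]
      exact Finset.mem_univ v
    · intro hG
      have : isolatedVertices G = univ := by
        ext v; simp [mem_isolatedVertices, hG v]
      rw [this, Finset.card_univ, Fintype.card_fin]
  have hle : n * (1 - (p : ℝ)) ^ (n - 1) - (1 - (p : ℝ)) ^ (n.choose 2) ≤ meanExcess n p := by
    rw [← hall, ← integral_card_isolatedVertices, ← integral_indicator_one .of_discrete,
      ← integral_sub .of_finite .of_finite, meanExcess]
    refine integral_mono .of_finite .of_finite fun G => ?_
    dsimp only
    obtain ⟨h1, h2⟩ := card_isolatedVertices_le_numComponents G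
    by_cases hG : #(isolatedVertices G) = n
    · rw [Set.indicator_of_mem (by exact hG)]
      have : (#(isolatedVertices G) : ℝ) ≤ numComponents G := by exact_mod_cast h1
      simpa using this
    · rw [Set.indicator_of_notMem (by exact hG)]
      have : (#(isolatedVertices G) : ℝ) + 1 ≤ numComponents G := by exact_mod_cast h2 hG
      linarith
  have hc : n ≤ n.choose 2 := by
    obtain ⟨m, rfl⟩ : ∃ m, n = m + 3 := ⟨n - 3, by omega⟩
    simp only [Nat.choose_succ_succ' _ 1, Nat.choose_one_right, Nat.reduceAdd]
    omega
  have h1 : (1 - (p : ℝ)) ^ (n.choose 2) ≤ (1 - (p : ℝ)) ^ n := pow_le_pow_of_le_one hq0 hq1 hc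
  have h2 : (1 - (p : ℝ)) ^ n ≤ (1 - (p : ℝ)) ^ (n - 1) :=
    pow_le_pow_of_le_one hq0 hq1 (by omega)
  have h3 := mul_le_mul_of_nonneg_left h2 (Nat.cast_nonneg (α := ℝ) n)
  linarith

theorem meanExcess_le_card (n : ℕ) (p : I) : meanExcess n p ≤ n := by
  have h : meanExcess n p ≤ ∫ _, (n : ℝ) ∂(binomialRandom (Fin n) p) := by
    refine integral_mono .of_finite .of_finite fun G => ?_
    dsimp only
    have : numComponents G ≤ n := by
      classical
      rw [numComponents, Nat.card_eq_fintype_card]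
      calc Fintype.card G.ConnectedComponent ≤ Fintype.card (Fin n) :=
            Fintype.card_le_of_surjective G.connectedComponentMk Quot.mk_surjective
        _ = n := Fintype.card_fin n
    have : (numComponents G : ℝ) ≤ n := by exact_mod_cast this
    linarith
  simpa using h

/-- The expected number of closed sets of at least two and at most `n / 2` vertices that span
enough edges to be connected. -/
noncomputable def meanSmallRichSets (n : ℕ) (p : I) : ℝ :=
  ∫ G, (#(smallRichSets G) : ℝ) ∂(binomialRandom (Fin n) p)

theorem meanExcess_le (n : ℕ) (p : I) :
    meanExcess n p ≤ n * (1 - (p : ℝ)) ^ (n - 1) + meanSmallRichSets n p := by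
  rw [← integral_card_isolatedVertices, meanSmallRichSets, ← integral_add .of_finite .of_finite,
    meanExcess]
  refine integral_mono .of_finite .of_finite fun G => ?_
  dsimp only
  have : (numComponents G : ℝ) ≤ 1 + #(isolatedVertices G) + #(smallRichSets G) := by
    exact_mod_cast numComponents_le G
  linarith

/-- A disconnected graph without isolated vertices has a component of at least two and at most
`n / 2` vertices. -/
theorem one_sub_connProb_le {n : ℕ} (hn : 1 ≤ n) (p : I) :
    1 - connProb n p ≤ isolProb n p + meanSmallRichSets n p := by
  rw [meanSmallRichSets, isolProb, connProb, ← probReal_compl_eq_one_sub .of_discrete,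
    ← integral_indicator_one .of_discrete, ← integral_indicator_one .of_discrete,
    ← integral_add .of_finite .of_finite]
  refine integral_mono .of_finite .of_finite fun G => ?_
  dsimp only
  have hI : 0 ≤ ({G | ∃ v, G.IsIsolated v} : Set (SimpleGraph (Fin n))).indicator 
      (1 : SimpleGraph (Fin n) → ℝ) G :=
    Set.indicator_nonneg (fun _ _ => zero_le_one) _
  by_cases hG : G.Connected
  · rw [Set.indicator_of_notMem (by simpa using hG)]
    positivity
  rw [Set.indicator_of_mem (by simpa using hG)]
  by_cases hiso : ∃ v, G.IsIsolated v
  · rw [Set.indicator_of_mem (by exact hiso)]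
    simp
  · have h0 : #(isolatedVertices G) = 0 := by
      simpa [Finset.ext_iff, mem_isolatedVertices] using hiso
    have h1 := numComponents_le G
    have h2 : 2 ≤ numComponents G := by
      by_contra hlt
      apply hG
      have : Nonempty (Fin n) := ⟨⟨0, hn⟩⟩
      have hsub : Subsingleton G.ConnectedComponent := by
        rw [← Finite.card_le_one_iff_subsingleton]
        change numComponents G ≤ 1
        omega
      exact ⟨fun u v => ConnectedComponent.exact (Subsingleton.elim _ _)⟩
    have h3 : (1 : ℝ) ≤ #(smallRichSets G) := by exact_mod_cast (by omega)
    simp only [Pi.one_apply]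
    linarith

theorem meanSmallRichSets_le_sum (n : ℕ) (p : I) :
    meanSmallRichSets n p ≤ ∑ k ∈ Icc 2 (n / 2), n.choose k *
      ((k.choose 2).choose (k - 1) * ((p : ℝ) ^ (k - 1) * (1 - (p : ℝ)) ^ (k * (n - k)))) := by
  classical
  set f : ℕ → ℝ := fun k => if k ∈ Icc 2 (n / 2) then
      ((k.choose 2).choose (k - 1) * ((p : ℝ) ^ (k - 1) * (1 - (p : ℝ)) ^ (k * (n - k)))) else 0
    with hf
  have hR : ∑ k ∈ Icc 2 (n / 2), n.choose k *
      ((k.choose 2).choose (k - 1) * ((p : ℝ) ^ (k - 1) * (1 - (p : ℝ)) ^ (k * (n - k)))) =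
      ∑ S ∈ (univ : Finset (Fin n)).powerset, f #S := by
    rw [Finset.sum_powerset_apply_card f, Finset.card_univ, Fintype.card_fin]
    have hA : ∑ k ∈ Icc 2 (n / 2), n.choose k *
        ((k.choose 2).choose (k - 1) * ((p : ℝ) ^ (k - 1) * (1 - (p : ℝ)) ^ (k * (n - k)))) =
        ∑ k ∈ Icc 2 (n / 2), n.choose k • f k :=
      Finset.sum_congr rfl fun k hk => by simp only [hf, hk, if_true, nsmul_eq_mul]
    rw [hA]
    refine Finset.sum_subset (fun k hk => ?_) fun k _ hk => ?_
    · rw [Finset.mem_Icc] at hk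
      rw [Finset.mem_range]
      omega
    · simp only [hf, hk, if_false, smul_zero]
  rw [hR]
  have hcount := sum_real_eq_integral_card (binomialRandom (Fin n) p)
    ((univ : Finset (Fin n)).powerset.filter fun S => #S ∈ Icc 2 (n / 2))
    (fun S => {G | IsRichClosedSet G S})
  have hfil : ∀ G : SimpleGraph (Fin n), {S ∈ ((univ : Finset (Fin n)).powerset.filter
      fun S => #S ∈ Icc 2 (n / 2)) | G ∈ {G : SimpleGraph (Fin n) | IsRichClosedSet G S}} =
      smallRichSets G := by
    intro G
    ext S
    simp only [smallRichSets, Finset.powerset_univ, Finset.mem_filter, Finset.mem_univ, true_and,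
      Finset.mem_Icc, Set.mem_ofPred_eq]
    refine and_congr_left fun _ => ?_
    omega
  simp_rw [hfil] at hcount
  rw [meanSmallRichSets, ← hcount, Finset.sum_filter]
  refine Finset.sum_le_sum fun S _ => ?_
  simp only [hf]
  split_ifs with h
  · exact real_isRichClosedSet_le n p S
  · exact le_rfl

/-! ### The contribution of small components with more than one vertex -/

theorem self_pow_le_three_pow_mul_factorial (k : ℕ) : (k : ℝ) ^ k ≤ 3 ^ k * k.factorial := by
  have h := Real.pow_div_factorial_le_exp (x := (k : ℝ)) (Nat.cast_nonneg k) k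
  have h3 : Real.exp k ≤ 3 ^ k := by
    calc Real.exp k = Real.exp 1 ^ k := by rw [← Real.exp_nat_mul, mul_one]
      _ ≤ 3 ^ k := by gcongr; exact Real.exp_one_lt_three.le
  rw [div_le_iff₀ (by positivity)] at h
  exact h.trans (by gcongr)

/-- The ratio `(9 / 2) n p q ^ ⌊(n - 1) / 2⌋` of the geometric series that bounds
`meanSmallRichSets`. The rounded-down exponent is a lower bound for `n - k - 1` when `k ≤ n / 2`. -/
noncomputable def smallRatio (n : ℕ) (p : I) : ℝ :=
  9 / 2 * n * p * (1 - (p : ℝ)) ^ ((n - 1) / 2)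

theorem smallRatio_nonneg (n : ℕ) (p : I) : 0 ≤ smallRatio n p := by
  have := one_sub_coe_nonneg p
  have := p.2.1
  unfold smallRatio
  positivity

/-- With `j = k - 1`, the exponent `k (n - k)` splits as `(n - 1) + j (n - k - 1)`, and the two
binomial coefficients are controlled by `m ^ m ≤ 3 ^ m * m!`. -/
theorem rich_term_le {n k : ℕ} (hk : 1 ≤ k) (hkn : 2 * k ≤ n) (p : I) :
    n.choose k * ((k.choose 2).choose (k - 1) *
      ((p : ℝ) ^ (k - 1) * (1 - (p : ℝ)) ^ (k * (n - k)))) ≤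
      3 * (n * (1 - (p : ℝ)) ^ (n - 1)) * smallRatio n p ^ (k - 1) := by
  have hq0 := one_sub_coe_nonneg p
  have hq1 := one_sub_coe_le_one p
  have hp0 : (0 : ℝ) ≤ p := p.2.1
  set q := 1 - (p : ℝ) with hq
  obtain ⟨j, rfl⟩ : ∃ j, k = j + 1 := ⟨k - 1, by omega⟩
  simp only [Nat.add_sub_cancel]
  have h1 : (n.choose (j + 1) : ℝ) ≤ n ^ (j + 1) / (j + 1).factorial :=
    Nat.choose_le_pow_div (j + 1) n
  have h2 : (((j + 1).choose 2).choose j : ℝ) ≤ (((j + 1 : ℕ) : ℝ) * j / 2) ^ j / j.factorial := by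
    have h := Nat.choose_le_pow_div (α := ℝ) j ((j + 1).choose 2)
    rwa [Nat.cast_choose_two, Nat.cast_succ, add_sub_cancel_right, ← Nat.cast_succ] at h
  have h3 : (j : ℝ) ^ j / j.factorial ≤ 3 ^ j := by
    rw [div_le_iff₀ (by positivity)]
    exact self_pow_le_three_pow_mul_factorial j
  have h4 : ((j + 1 : ℕ) : ℝ) ^ j / (j + 1).factorial ≤ 3 ^ (j + 1) := by
    rw [div_le_iff₀ (by positivity)]
    refine le_trans ?_ (self_pow_le_three_pow_mul_factorial (j + 1))
    exact pow_le_pow_right₀ (by push_cast; linarith [(Nat.cast_nonneg j : (0 : ℝ) ≤ j)])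
      (Nat.le_succ j)
  have hexp : q ^ ((j + 1) * (n - (j + 1))) ≤ q ^ (n - 1) * (q ^ ((n - 1) / 2)) ^ j := by
    rw [← pow_mul, ← pow_add]
    refine pow_le_pow_of_le_one hq0 hq1 ?_
    obtain ⟨m, rfl⟩ : ∃ m, n = (j + 1) + m := ⟨n - (j + 1), by omega⟩
    have hle : (j + 1 + m - 1) / 2 ≤ m - 1 ∨ j = 0 := by omega
    rw [Nat.add_sub_cancel_left]
    rcases hle with hle | rfl
    · calc j + 1 + m - 1 + (j + 1 + m - 1) / 2 * j ≤ j + m + (m - 1) * j := by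
            gcongr; omega
        _ ≤ (j + 1) * m := by
            obtain ⟨m', rfl⟩ : ∃ m', m = m' + 1 := ⟨m - 1, by omega⟩
            rw [Nat.add_sub_cancel]
            apply le_of_eq
            ring
    · simp
  calc _ ≤ (n : ℝ) ^ (j + 1) / (j + 1).factorial *
        ((((j + 1 : ℕ) : ℝ) * j / 2) ^ j / j.factorial *
        ((p : ℝ) ^ j * (q ^ (n - 1) * (q ^ ((n - 1) / 2)) ^ j))) := by
        gcongr
    _ = (((j + 1 : ℕ) : ℝ) ^ j / (j + 1).factorial) * ((j : ℝ) ^ j / j.factorial) *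
        ((n * q ^ (n - 1)) * (1 / 2 * n * p * q ^ ((n - 1) / 2)) ^ j) := by
        simp only [mul_pow, div_pow, pow_succ]
        ring
    _ ≤ 3 ^ (j + 1) * 3 ^ j *
        ((n * q ^ (n - 1)) * (1 / 2 * n * p * q ^ ((n - 1) / 2)) ^ j) := by
        gcongr
    _ = _ := by
        rw [smallRatio, ← hq, show (9 / 2 * n * p * q ^ ((n - 1) / 2) : ℝ) =
          3 * (3 * (1 / 2 * n * p * q ^ ((n - 1) / 2))) by ring, mul_pow 3, mul_pow 3]
        ring

theorem meanSmallRichSets_le {n : ℕ} {p : I} (hz : smallRatio n p ≤ 1 / 2) :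
    meanSmallRichSets n p ≤ 6 * smallRatio n p * (n * (1 - (p : ℝ)) ^ (n - 1)) := by
  have hq0 := one_sub_coe_nonneg p
  have hz0 := smallRatio_nonneg n p
  set z := smallRatio n p with hzdef
  refine (meanSmallRichSets_le_sum n p).trans ?_
  have hterm : ∀ k ∈ Icc 2 (n / 2), (n.choose k * ((k.choose 2).choose (k - 1) *
      ((p : ℝ) ^ (k - 1) * (1 - (p : ℝ)) ^ (k * (n - k)))) : ℝ) ≤
      6 * z * (n * (1 - (p : ℝ)) ^ (n - 1)) * (1 / 2) ^ (k - 1) := by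
    intro k hk
    rw [Finset.mem_Icc] at hk
    refine (rich_term_le (by omega) (by omega) p).trans ?_
    obtain ⟨j, rfl⟩ : ∃ j, k = j + 1 + 1 := ⟨k - 2, by omega⟩
    rw [Nat.add_sub_cancel, ← hzdef, pow_succ]
    calc 3 * (n * (1 - (p : ℝ)) ^ (n - 1)) * (z ^ j * z)
        ≤ 3 * (n * (1 - (p : ℝ)) ^ (n - 1)) * ((1 / 2) ^ j * z) := by gcongr
      _ = _ := by rw [pow_succ]; ring
  refine (Finset.sum_le_sum hterm).trans ?_
  rw [← Finset.mul_sum]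
  have h1 := sum_half_pow_le (Icc 2 (n / 2)) (fun k => k - 1)
    (by
      intro a ha b hb h
      simp only [Finset.coe_Icc, Set.mem_Icc] at ha hb h
      omega)
    (by
      intro k hk
      rw [Finset.mem_Icc] at hk
      omega)
  have h2 : 0 ≤ 6 * z * (n * (1 - (p : ℝ)) ^ (n - 1)) := by positivity
  exact mul_le_of_le_one_right h2 h1

theorem mul_mul_one_sub_pow_le_one (j : ℕ) (p : I) : (j : ℝ) * p * (1 - (p : ℝ)) ^ j ≤ 1 := by
  have hq0 := one_sub_coe_nonneg p
  have hq1 := one_sub_coe_le_one p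
  have hp0 : (0 : ℝ) ≤ p := p.2.1
  have h := mul_neg_geom_sum (1 - (p : ℝ)) j
  rw [sub_sub_cancel] at h
  have hsum : (j : ℝ) * (1 - (p : ℝ)) ^ j ≤ ∑ i ∈ range j, (1 - (p : ℝ)) ^ i := by
    have : ∑ _i ∈ range j, (1 - (p : ℝ)) ^ j ≤ ∑ i ∈ range j, (1 - (p : ℝ)) ^ i :=
      Finset.sum_le_sum fun i hi =>
        pow_le_pow_of_le_one hq0 hq1 (Finset.mem_range.1 hi).le
    simpa using this
  have := mul_le_mul_of_nonneg_left hsum hp0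
  have := pow_nonneg hq0 j
  nlinarith

/-- The ratio `smallRatio n p` is small when `(1 - p) ^ n` is: half of the exponent `(n - 1) / 2`
absorbs the factor `n p`. -/
theorem smallRatio_pow_le {n : ℕ} (hn : 8 ≤ n) (p : I) :
    smallRatio n p ^ 8 ≤ 36 ^ 8 * (1 - (p : ℝ)) ^ n := by
  have hq0 := one_sub_coe_nonneg p
  have hq1 := one_sub_coe_le_one p
  have hp0 : (0 : ℝ) ≤ p := p.2.1
  have hz0 := smallRatio_nonneg n p
  obtain ⟨j, hj1, hj2⟩ : ∃ j, 2 * j ≤ (n - 1) / 2 ∧ n ≤ 8 * j :=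
    ⟨(n - 1) / 2 / 2, by omega, by omega⟩
  have hj2' : (n : ℝ) ≤ 8 * j := by exact_mod_cast hj2
  have hz : smallRatio n p ≤ 36 * (1 - (p : ℝ)) ^ j := by
    calc smallRatio n p ≤ 9 / 2 * (8 * j) * p * (1 - (p : ℝ)) ^ (2 * j) := by
          unfold smallRatio
          gcongr ?_ * ?_
          · gcongr
          · exact pow_le_pow_of_le_one hq0 hq1 hj1
      _ = 36 * (j * p * (1 - (p : ℝ)) ^ j) * (1 - (p : ℝ)) ^ j := by
          rw [two_mul, pow_add]; ring
      _ ≤ 36 * 1 * (1 - (p : ℝ)) ^ j := by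
          gcongr
          exact mul_mul_one_sub_pow_le_one j p
      _ = _ := by ring
  calc smallRatio n p ^ 8 ≤ (36 * (1 - (p : ℝ)) ^ j) ^ 8 := by gcongr
    _ = 36 ^ 8 * (1 - (p : ℝ)) ^ (8 * j) := by rw [mul_pow, ← pow_mul, mul_comm j]
    _ ≤ 36 ^ 8 * (1 - (p : ℝ)) ^ n := by
        gcongr ?_ * ?_
        exact pow_le_pow_of_le_one hq0 hq1 hj2

theorem tendsto_smallRatio {l : Filter ℕ} (hl : l ≤ atTop) {p : ℕ → I}
    (h : Tendsto (fun n : ℕ => (1 - (p n : ℝ)) ^ n) l (𝓝 0)) :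
    Tendsto (fun n => smallRatio n (p n)) l (𝓝 0) := by
  have h8 : Tendsto (fun n => smallRatio n (p n) ^ 8) l (𝓝 0) := by
    refine squeeze_zero' (.of_forall fun n => pow_nonneg (smallRatio_nonneg n (p n)) 8)
      (((eventually_ge_atTop 8).filter_mono hl).mono fun n hn => smallRatio_pow_le hn (p n)) ?_
    simpa using h.const_mul (36 ^ 8)
  have hroot := h8.rpow_const (p := (8 : ℝ)⁻¹) (Or.inr (by norm_num))
  rw [Real.zero_rpow (by norm_num)] at hroot
  refine hroot.congr fun n => ?_
  exact Real.pow_rpow_inv_natCast (smallRatio_nonneg n (p n)) (by norm_num)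

/-! ### Asymptotics -/

/-- If `n (1 - p) ^ n` stays away from zero, then `p ≤ (log n - log C) / n` tends to zero. -/
theorem tendsto_edgeProb {l : Filter ℕ} (hl : l ≤ atTop) {p : ℕ → I} {C : ℝ} (hC : 0 < C)
    (h : ∀ᶠ n : ℕ in l, C ≤ n * (1 - (p n : ℝ)) ^ n) : Tendsto (fun n => (p n : ℝ)) l (𝓝 0) := by
  have hlim : Tendsto (fun n : ℕ => (Real.log n - Real.log C) / n) atTop (𝓝 0) := by
    have h1 : Tendsto (fun n : ℕ => Real.log n / n) atTop (𝓝 0) :=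
      (Real.isLittleO_log_id_atTop.tendsto_div_nhds_zero).comp tendsto_natCast_atTop_atTop
    have h2 : Tendsto (fun n : ℕ => Real.log C / n) atTop (𝓝 0) :=
      tendsto_const_div_atTop_nhds_zero_nat _
    simpa [sub_div] using h1.sub h2
  refine squeeze_zero' (.of_forall fun n => (p n).2.1) ?_ (hlim.mono_left hl)
  filter_upwards [h, (eventually_ge_atTop 1).filter_mono hl] with n hn hn1
  have hn0 : (0 : ℝ) < n := by exact_mod_cast hn1
  have hpow : 0 < (1 - (p n : ℝ)) ^ n := by
    by_contra hneg
    nlinarith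
  have hq : 0 < 1 - (p n : ℝ) := by
    refine (one_sub_coe_nonneg (p n)).lt_of_ne fun h0 => ?_
    rw [← h0, zero_pow (by omega)] at hpow
    exact lt_irrefl _ hpow
  have hlog := Real.log_le_log hC hn
  rw [Real.log_mul hn0.ne' hpow.ne', Real.log_pow] at hlog
  have := Real.log_le_sub_one_of_pos hq
  rw [le_div_iff₀ hn0]
  nlinarith

theorem mul_pow_pred_eq {n : ℕ} (hn : 1 ≤ n) {q : ℝ} (hq : q ≠ 0) :
    n * q ^ (n - 1) = n * q ^ n / q := by
  obtain ⟨m, rfl⟩ : ∃ m, n = m + 1 := ⟨n - 1, by omega⟩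
  rw [Nat.add_sub_cancel, pow_succ]
  field_simp

theorem tendsto_mul_pow_div_meanExcess {l : Filter ℕ} (hl : l ≤ atTop) {p : ℕ → I} {C : ℝ}
    (hC : 0 < C) (h : ∀ᶠ n : ℕ in l, C ≤ n * (1 - (p n : ℝ)) ^ n)
    (h0 : Tendsto (fun n : ℕ => (1 - (p n : ℝ)) ^ n) l (𝓝 0)) :
    Tendsto (fun n : ℕ => n * (1 - (p n : ℝ)) ^ n / meanExcess n (p n)) l (𝓝 1) := by
  have hp := tendsto_edgeProb hl hC h
  have hz := tendsto_smallRatio hl h0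
  have hq : Tendsto (fun n => 1 - (p n : ℝ)) l (𝓝 1) := by simpa using hp.const_sub 1
  have hlow : Tendsto (fun n : ℕ => 1 - 1 / (n : ℝ)) l (𝓝 1) := by
    simpa using (tendsto_one_div_atTop_nhds_zero_nat.const_sub (1 : ℝ)).mono_left hl
  have hup : Tendsto (fun n => (1 + 6 * smallRatio n (p n)) / (1 - (p n : ℝ))) l (𝓝 1) := by
    have hdiv := ((hz.const_mul 6).const_add 1).div hq one_ne_zero
    rw [mul_zero, add_zero, div_one] at hdiv
    exact hdiv
  have hmain : Tendsto (fun n : ℕ => meanExcess n (p n) / (n * (1 - (p n : ℝ)) ^ n)) l (𝓝 1) := by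
    refine tendsto_of_tendsto_of_tendsto_of_le_of_le' hlow hup ?_ ?_
    · filter_upwards [h, (eventually_ge_atTop 3).filter_mono hl] with n hn hn3
      have hn0 : (0 : ℝ) < n := by exact_mod_cast (by omega : 0 < n)
      rw [le_div_iff₀ (hC.trans_le hn)]
      refine le_trans (le_of_eq ?_) (le_meanExcess hn3 (p n))
      field_simp
    · filter_upwards [h, (eventually_ge_atTop 3).filter_mono hl,
        hz.eventually_le_const (by norm_num : (0 : ℝ) < 1 / 2),
        hq.eventually_const_lt (zero_lt_one)] with n hn hn3 hzn hqn
      rw [div_le_iff₀ (hC.trans_le hn)]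
      have h1 := meanExcess_le n (p n)
      have h2 := meanSmallRichSets_le hzn
      rw [mul_pow_pred_eq (by omega) hqn.ne'] at h1 h2
      refine h1.trans ((add_le_add le_rfl h2).trans (le_of_eq ?_))
      ring
  have hinv := hmain.inv₀ one_ne_zero
  rw [inv_one] at hinv
  exact hinv.congr fun n => inv_div _ _

/-- The numerical core of the bound for the probability of an isolated vertex: the Bonferroni
estimate for `0 < y = n q ^ n < 1` and `q` close to `1`. -/
theorem isolProb_le_mul_pow {n : ℕ} (hn : 5 ≤ n) {p : I} {C : ℝ}
    (hq : 0 < 1 - (p : ℝ)) (hq1 : (1 - (p : ℝ))⁻¹ ≤ 1 + C / 8)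
    (hq6 : ((1 - (p : ℝ)) ^ 6)⁻¹ ≤ 6 / 5) (hCy : C ≤ n * (1 - (p : ℝ)) ^ n)
    (hy1 : n * (1 - (p : ℝ)) ^ n ≤ 1) : isolProb n p ≤ n * (1 - (p : ℝ)) ^ n := by
  have hle1 := one_sub_coe_le_one p
  have hb := isolProb_le_bonferroni (by omega : 3 ≤ n) p
  set q := 1 - (p : ℝ)
  set y := n * q ^ n with hy
  have hn5 : (5 : ℝ) ≤ n := by exact_mod_cast hn
  have hy0 : 0 ≤ y := by positivity
  have h1 : n * q ^ (n - 1) ≤ y * (1 + C / 8) := by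
    rw [mul_pow_pred_eq (by omega) hq.ne', div_eq_mul_inv]
    gcongr
  have h2 : 2 / 5 * y ^ 2 ≤ n.choose 2 * q ^ (2 * n - 3) := by
    have hpow : q ^ (2 * n) ≤ q ^ (2 * n - 3) := pow_le_pow_of_le_one hq.le hle1 (by omega)
    have hch : 2 / 5 * (n : ℝ) ^ 2 ≤ n.choose 2 := by
      rw [Nat.cast_choose_two]
      nlinarith
    calc 2 / 5 * y ^ 2 = (2 / 5 * (n : ℝ) ^ 2) * q ^ (2 * n) := by
          rw [hy, mul_pow, ← pow_mul, mul_comm n 2]; ring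
      _ ≤ n.choose 2 * q ^ (2 * n - 3) := by gcongr
  have h3 : n.choose 3 * q ^ (3 * n - 6) ≤ y ^ 3 / 5 := by
    have hch : (n.choose 3 : ℝ) ≤ n ^ 3 / 6 := by
      have := Nat.choose_le_pow_div (α := ℝ) 3 n
      norm_num [Nat.factorial] at this
      exact this
    have hpow : q ^ (3 * n - 6) = q ^ (3 * n) * (q ^ 6)⁻¹ := by
      rw [eq_mul_inv_iff_mul_eq₀ (by positivity), ← pow_add]
      congr 1
      omega
    rw [hpow]
    calc (n.choose 3 : ℝ) * (q ^ (3 * n) * (q ^ 6)⁻¹)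
        ≤ (n : ℝ) ^ 3 / 6 * (q ^ (3 * n) * (6 / 5)) := by gcongr
      _ = y ^ 3 / 5 := by
        rw [hy, mul_pow, ← pow_mul, mul_comm n 3]; ring
  have h4 : y ^ 3 ≤ y ^ 2 := by
    have := sq_nonneg y
    nlinarith
  have h5 : y * C ≤ y ^ 2 := by nlinarith
  have h6 := sq_nonneg y
  linarith

/-- The two inequalities for `n (1 - p) ^ n` that do not hold for every `n`. They are trivial
when this quantity is at least `1`. -/
theorem eventually_le_mul_pow {p : ℕ → I} {C : ℝ} (hC : 0 < C)
    (h : ∀ᶠ n : ℕ in atTop, C ≤ n * (1 - (p n : ℝ)) ^ n) :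
    ∀ᶠ n : ℕ in atTop, isolProb n (p n) ≤ n * (1 - (p n : ℝ)) ^ n ∧
      1 - 2 * (n * (1 - (p n : ℝ)) ^ n) ≤ connProb n (p n) := by
  set T : Set ℕ := {n : ℕ | n * (1 - (p n : ℝ)) ^ n < 1} with hT
  have hl : atTop ⊓ 𝓟 T ≤ (atTop : Filter ℕ) := inf_le_left
  have hTev : ∀ᶠ n in atTop ⊓ 𝓟 T, n ∈ T := by
    rw [eventually_inf_principal]
    exact .of_forall fun n hn => hn
  have h0 : Tendsto (fun n : ℕ => (1 - (p n : ℝ)) ^ n) (atTop ⊓ 𝓟 T) (𝓝 0) := by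
    refine squeeze_zero' (.of_forall fun n => pow_nonneg (one_sub_coe_nonneg _) _) ?_
      (tendsto_one_div_atTop_nhds_zero_nat.mono_left hl)
    filter_upwards [hTev, (eventually_ge_atTop 1).filter_mono hl] with n hn hn1
    have hn0 : (0 : ℝ) < n := by exact_mod_cast hn1
    rw [le_div_iff₀ hn0, mul_comm]
    exact le_of_lt hn
  have hp := tendsto_edgeProb hl hC (h.filter_mono hl)
  have hz := tendsto_smallRatio hl h0
  have hq : Tendsto (fun n => 1 - (p n : ℝ)) (atTop ⊓ 𝓟 T) (𝓝 1) := by simpa using hp.const_sub 1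
  have hqi : Tendsto (fun n => (1 - (p n : ℝ))⁻¹) (atTop ⊓ 𝓟 T) (𝓝 1) := by
    simpa using hq.inv₀ one_ne_zero
  have hq6 : Tendsto (fun n => ((1 - (p n : ℝ)) ^ 6)⁻¹) (atTop ⊓ 𝓟 T) (𝓝 1) := by
    simpa using (hq.pow 6).inv₀ (by norm_num)
  have hev : ∀ᶠ n : ℕ in atTop ⊓ 𝓟 T, isolProb n (p n) ≤ n * (1 - (p n : ℝ)) ^ n ∧
      1 - 2 * (n * (1 - (p n : ℝ)) ^ n) ≤ connProb n (p n) := by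
    filter_upwards [hTev, (eventually_ge_atTop 5).filter_mono hl, h.filter_mono hl,
      hz.eventually_le_const (by norm_num : (0 : ℝ) < 1 / 12),
      hq.eventually_const_lt zero_lt_one,
      hqi.eventually_le_const (by linarith : (1 : ℝ) < 1 + C / 8),
      hqi.eventually_le_const (by norm_num : (1 : ℝ) < 2),
      hq6.eventually_le_const (by norm_num : (1 : ℝ) < 6 / 5)]
      with n hnT hn5 hCn hzn hqn hq1n hq2n hq6n
    have hiso := isolProb_le_mul_pow hn5 hqn hq1n hq6n hCn (le_of_lt hnT)
    refine ⟨hiso, ?_⟩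
    have h1 := one_sub_connProb_le (by omega : 1 ≤ n) (p n)
    have h2 := meanSmallRichSets_le (hzn.trans (by norm_num))
    rw [mul_pow_pred_eq (by omega) hqn.ne', div_eq_mul_inv] at h2
    have hy0 : 0 ≤ n * (1 - (p n : ℝ)) ^ n := hC.le.trans hCn
    have h3 : 6 * smallRatio n (p n) * (n * (1 - (p n : ℝ)) ^ n * (1 - (p n : ℝ))⁻¹) ≤
        6 * (1 / 12) * (n * (1 - (p n : ℝ)) ^ n * 2) := by
      have := inv_nonneg.2 hqn.le
      gcongr
    linarith
  rw [eventually_inf_principal] at hev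
  filter_upwards [hev] with n hn
  by_cases hnT : n ∈ T
  · exact hn hnT
  · have h1 : 1 ≤ n * (1 - (p n : ℝ)) ^ n := not_lt.1 hnT
    exact ⟨(isolProb_le_one _ _).trans h1, by linarith [connProb_nonneg n (p n)]⟩

/-- When `n (1 - p) ^ (4 n) ≥ 1`, the probability that there is no isolated vertex is at most
`1 / (2 n)`, so that the mean itself can take the place of `n (1 - p) ^ n` in all inequalities. -/
theorem meanExcess_inequalities {n : ℕ} (hn : 256 ≤ n) {p : I}
    (h : 1 ≤ n * ((1 - (p : ℝ)) ^ n) ^ 4) :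
    0 < meanExcess n p ∧ 1 - 2 * meanExcess n p ≤ connProb n p ∧
      connProb n p ≤ 1 / meanExcess n p ∧ 1 - 1 / meanExcess n p ≤ isolProb n p ∧
      isolProb n p ≤ meanExcess n p ∧ meanExcess n p * connProb n p ≤ isolProb (n + 1) p := by
  have hq0 := one_sub_coe_nonneg p
  have hq1 := one_sub_coe_le_one p
  have he1 := le_meanExcess (by omega : 3 ≤ n) p
  have he2 := meanExcess_le_card n p
  have hrec2 := mul_one_sub_isolProb_le_two n p
  have hrec1 := (mul_one_sub_isolProb_le_isolProb (n + 1) p).trans (isolProb_le_one _ _)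
  have hconn := connProb_le_one_sub_isolProb (by omega : 2 ≤ n) p
  have hc0 := connProb_nonneg n p
  have hi0 := isolProb_le_one n p
  have hi1 := isolProb_le_one (n + 1) p
  set q := 1 - (p : ℝ)
  set e := meanExcess n p
  have hn' : (256 : ℝ) ≤ n := by exact_mod_cast hn
  have hy0 : 0 ≤ q ^ n := pow_nonneg hq0 n
  have hy1 : q ^ n ≤ 1 := pow_le_one₀ hq0 hq1
  have hcube : (q ^ n) ^ 3 ≤ q ^ n := pow_le_of_le_one hy0 hy1 (by norm_num)
  have h4 : 4 ≤ n * (q ^ n) ^ 3 := by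
    refine le_of_pow_le_pow_left₀ (n := 4) (by norm_num) (by positivity) ?_
    calc (4 : ℝ) ^ 4 ≤ n * 1 ^ 3 := by norm_num; exact hn
      _ ≤ n * (n * (q ^ n) ^ 4) ^ 3 := by gcongr
      _ = (n * (q ^ n) ^ 3) ^ 4 := by ring
  have he : 2 ≤ e := by nlinarith
  -- Both recursions are weakened by replacing the powers of `q` with `q ^ (3 n)`.
  have hpow2 : (q ^ n) ^ 3 ≤ q ^ (2 * n + 1) := by
    rw [← pow_mul]
    exact pow_le_pow_of_le_one hq0 hq1 (by omega)
  have hpow1 : (q ^ n) ^ 3 ≤ q ^ (n + 1) := by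
    rw [← pow_mul]
    exact pow_le_pow_of_le_one hq0 hq1 (by omega)
  have hD0 : 0 ≤ 1 - isolProb n p := sub_nonneg.2 hi0
  have hD0' : 0 ≤ 1 - isolProb (n + 1) p := sub_nonneg.2 hi1
  have hD : n * (1 - isolProb n p) ≤ 1 / 2 := by
    have : n * 4 * (1 - isolProb n p) ≤ 2 := by
      refine le_trans (mul_le_mul_of_nonneg_right ?_ hD0) hrec2
      calc (n : ℝ) * 4 ≤ n * (n * (q ^ n) ^ 3) := by gcongr
        _ = n * n * (q ^ n) ^ 3 := by ring
        _ ≤ (n + 2) * (n + 1) * q ^ (2 * n + 1) := by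
          gcongr <;> linarith
    linarith
  have hD' : 4 * (1 - isolProb (n + 1) p) ≤ 1 := by
    refine le_trans ?_ hrec1
    gcongr
    refine h4.trans ?_
    push_cast
    gcongr
    linarith
  have heD : e * (1 - isolProb n p) ≤ 1 / 2 := le_trans (by gcongr) hD
  have hec : e * connProb n p ≤ 1 / 2 := le_trans (by gcongr) heD
  refine ⟨by linarith, by linarith, ?_, ?_, by linarith, by linarith⟩
  · rw [le_div_iff₀ (by linarith), mul_comm]
    linarith
  · have : 1 - isolProb n p ≤ 1 / e := by
      rw [le_div_iff₀ (by linarith), mul_comm]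
      linarith
    linarith

end RandomGraph

theorem mainTheorem1 :
    (∀ (n : ℕ) (p : I), 1 ≤ n → p < 1 →
      1 - 2 * n * (1 - (p : ℝ)) ^ (n - 1) ≤ RandomGraph.connProb n p ∧
      RandomGraph.connProb n p ≤ 1 / (n * (1 - (p : ℝ)) ^ n) ∧
      1 - 1 / (n * (1 - (p : ℝ)) ^ n) ≤ RandomGraph.isolProb n p ∧
      RandomGraph.isolProb n p ≤ n * (1 - (p : ℝ)) ^ (n - 1) ∧
      n * (1 - (p : ℝ)) ^ n * RandomGraph.connProb n p ≤ RandomGraph.isolProb (n + 1) p) ∧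
    (∀ (p : ℕ → I) (C : ℝ), 0 < C →
      (∀ᶠ n : ℕ in atTop, C ≤ n * (1 - (p n : ℝ)) ^ n) →
      ∃ ε : ℕ → ℝ, Tendsto ε atTop (𝓝 0) ∧
        (∀ᶠ n : ℕ in atTop,
          0 < RandomGraph.meanExcess n (p n) * (1 + ε n) ∧
          1 - 2 * (RandomGraph.meanExcess n (p n) * (1 + ε n)) ≤ RandomGraph.connProb n (p n) ∧
          RandomGraph.connProb n (p n) ≤ 1 / (RandomGraph.meanExcess n (p n) * (1 + ε n)) ∧
          1 - 1 / (RandomGraph.meanExcess n (p n) * (1 + ε n)) ≤ RandomGraph.isolProb n (p n) ∧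
          RandomGraph.isolProb n (p n) ≤ RandomGraph.meanExcess n (p n) * (1 + ε n) ∧
          RandomGraph.meanExcess n (p n) * (1 + ε n) * RandomGraph.connProb n (p n)
            ≤ RandomGraph.isolProb (n + 1) (p n)) ∧
        (Tendsto (fun n : ℕ => (1 - (p n : ℝ)) ^ n) atTop (𝓝 0) →
          ∀ᶠ n : ℕ in atTop,
            (n : ℝ) * (1 - (p n : ℝ)) ^ n = RandomGraph.meanExcess n (p n) * (1 + ε n))) := by
  classical
  refine ⟨fun n p hn hp => ⟨RandomGraph.one_sub_le_connProb hn p, RandomGraph.connProb_le hn hp,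
    RandomGraph.one_sub_le_isolProb hn hp, RandomGraph.isolProb_le n p,
    RandomGraph.mul_connProb_le_isolProb n p⟩, fun p C hC h => ?_⟩
  -- `n ∈ T` are the indices for which `X n` is chosen to be `n q ^ n`; for the others it is the
  -- mean itself.
  set T : Set ℕ := {n : ℕ | Tendsto (fun n : ℕ => (1 - (p n : ℝ)) ^ n) atTop (𝓝 0) ∨
    n * ((1 - (p n : ℝ)) ^ n) ^ 4 < 1} with hT
  have hl : atTop ⊓ 𝓟 T ≤ (atTop : Filter ℕ) := inf_le_left
  have h0 : Tendsto (fun n : ℕ => (1 - (p n : ℝ)) ^ n) (atTop ⊓ 𝓟 T) (𝓝 0) := by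
    by_cases hlim : Tendsto (fun n : ℕ => (1 - (p n : ℝ)) ^ n) atTop (𝓝 0)
    · exact hlim.mono_left hl
    have hTev : ∀ᶠ n in atTop ⊓ 𝓟 T, n ∈ T := by
      rw [eventually_inf_principal]
      exact .of_forall fun n hn => hn
    have h4 : Tendsto (fun n : ℕ => ((1 - (p n : ℝ)) ^ n) ^ 4) (atTop ⊓ 𝓟 T) (𝓝 0) := by
      refine squeeze_zero'
        (.of_forall fun n => pow_nonneg (pow_nonneg (RandomGraph.one_sub_coe_nonneg _) _) _) ?_
        (tendsto_one_div_atTop_nhds_zero_nat.mono_left hl)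
      filter_upwards [hTev, (eventually_ge_atTop 1).filter_mono hl] with n hn hn1
      have hn0 : (0 : ℝ) < n := by exact_mod_cast hn1
      rw [le_div_iff₀ hn0, mul_comm]
      exact (hn.resolve_left hlim).le
    have hroot := h4.rpow_const (p := (4 : ℝ)⁻¹) (Or.inr (by norm_num))
    rw [Real.zero_rpow (by norm_num)] at hroot
    refine hroot.congr fun n => ?_
    exact Real.pow_rpow_inv_natCast (pow_nonneg (RandomGraph.one_sub_coe_nonneg _) _)
      (by norm_num)
  have hX : ∀ᶠ n : ℕ in atTop, RandomGraph.meanExcess n (p n) *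
      (1 + (n * (1 - (p n : ℝ)) ^ n / RandomGraph.meanExcess n (p n) - 1)) =
      n * (1 - (p n : ℝ)) ^ n := by
    filter_upwards [h, eventually_ge_atTop 3] with n hn hn3
    have hn3' : (3 : ℝ) ≤ n := by exact_mod_cast hn3
    have hpow : 0 < (1 - (p n : ℝ)) ^ n := by
      by_contra hneg
      nlinarith
    have he : 0 < RandomGraph.meanExcess n (p n) :=
      lt_of_lt_of_le (by nlinarith) (RandomGraph.le_meanExcess hn3 (p n))
    field_simp
    ring
  refine ⟨fun n => if n ∈ T then n * (1 - (p n : ℝ)) ^ n / RandomGraph.meanExcess n (p n) - 1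
    else 0, ?_, ?_, ?_⟩
  · refine Tendsto.if ?_ tendsto_const_nhds
    simpa using (RandomGraph.tendsto_mul_pow_div_meanExcess hl hC (h.filter_mono hl) h0).sub_const 1
  · filter_upwards [h, hX, RandomGraph.eventually_le_mul_pow hC h, eventually_ge_atTop 256]
      with n hn hXn hle hn256
    by_cases hnT : n ∈ T
    · have hy : 0 < n * (1 - (p n : ℝ)) ^ n := hC.trans_le hn
      have hp1 : p n < 1 := by
        refine lt_of_le_of_ne (p n).2.2 fun h1 => ?_
        rw [h1] at hy
        simp [show n ≠ 0 by omega] at hy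
      simp only [hnT, if_true, hXn]
      exact ⟨hy, hle.2, RandomGraph.connProb_le (by omega) hp1,
        RandomGraph.one_sub_le_isolProb (by omega) hp1, hle.1,
        RandomGraph.mul_connProb_le_isolProb n (p n)⟩
    · simp only [hnT, if_false, add_zero, mul_one]
      exact RandomGraph.meanExcess_inequalities hn256 (not_lt.1 (not_or.1 hnT).2)
  · intro hlim
    filter_upwards [hX] with n hXn
    have hnT : n ∈ T := Or.inl hlim
    simp only [hnT, if_true, hXn]
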